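/- Let $(R,\mathfrak m)$ be a Cohen–Macaulay (Noetherian) local ring of dimension $d>0$ with infinite residue field, let $I$ be an $\mathfrak m$-primary ideal of $R$, and let $J\subseteq I$ be a minimal reduction of $I$, that is, an ideal minimal with respect to inclusion among the ideals $K\subseteq I$ such that $I^{n+1}=KI^n$ for some $n\ge 0$. Let $F(I)=\bigoplus_{n\ge 0} I^n/\mathfrak m I^n$ be the fiber cone of $I$, let $\operatorname{depth} F(I)$ denote its depth with respect to the homogeneous maximal ideal $F(I)_+=\bigoplus_{n\ge 1} I^n/\mathfrak m I^n$, and let $\lambda(-)$ denote the length of an $R$-module. Suppose that $$I^3=JI^2\qquad\text{and}\qquad \lambda\big((\mathfrak m I^2\cap J)/\mathfrak m JI\big)=1.$$ (a) If $\lambda(I^2/JI)=1$, then $\operatorname{depth} F(I)\ge d-1$. (b) If $\lambda(I^2/JI)=2$, then $\operatorname{depth} F(I)\ge d-2$. -/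

import Mathlib

open IsLocalRing

/-- The depth (grade) of a commutative ring `A` with respect to an ideal `𝔞`: the supremum of the
lengths of the `A`-regular sequences whose terms lie in `𝔞`. -/
noncomputable def ringDepth {A : Type*} [CommRing A] (𝔞 : Ideal A) : ℕ∞ :=
  ⨆ rs ∈ {rs : List A | (∀ r ∈ rs, r ∈ 𝔞) ∧ RingTheory.Sequence.IsRegular A rs},
    (rs.length : ℕ∞)

/-- A Cohen-Macaulay local ring: a Noetherian local ring whose depth (with respect to its
maximal ideal) is equal to its Krull dimension. -/
def IsCohenMacaulayLocal (R : Type*) [CommRing R] [IsLocalRing R] : Prop :=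
  IsNoetherianRing R ∧ ((ringDepth (maximalIdeal R) : ℕ∞) : WithBot ℕ∞) = ringKrullDim R

/-- `J` is a reduction of `I`: `J ⊆ I` and `I ^ (n + 1) = J * I ^ n` for some `n ≥ 0`. -/
def IsReduction {R : Type*} [CommRing R] (J I : Ideal R) : Prop :=
  J ≤ I ∧ ∃ n : ℕ, I ^ (n + 1) = J * I ^ n

/-- `J` is a minimal reduction of `I`: a reduction of `I` that is minimal, with respect to
inclusion, among all reductions of `I`. -/
def IsMinimalReduction {R : Type*} [CommRing R] (J I : Ideal R) : Prop :=
  Minimal (fun K : Ideal R => IsReduction K I) J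

/-- `λ(A / B)`, the length of the `R`-module `A / B`, for ideals `B ⊆ A` of `R`. -/
noncomputable def quotLength {R : Type*} [CommRing R] (A B : Ideal R) : ℕ∞ :=
  Module.length R (A ⧸ Submodule.submoduleOf B A)

/-- The ideal `⨁ 𝔪 Iⁿ tⁿ` of the Rees algebra `⨁ Iⁿ tⁿ ⊆ R[t]`. -/
def fiberConeRel {R : Type*} [CommRing R] [IsLocalRing R] (I : Ideal R) :
    Ideal (reesAlgebra I) where
  carrier := {f | ∀ n, (f : Polynomial R).coeff n ∈ maximalIdeal R * I ^ n}
  add_mem' := fun {f g} hf hg n => by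
    simpa using add_mem (hf n) (hg n)
  zero_mem' := fun n => by simp
  smul_mem' := fun f g hg n => by
    have h : ((f • g : reesAlgebra I) : Polynomial R) = (f : Polynomial R) * g := rfl
    rw [h, Polynomial.coeff_mul]
    refine Ideal.sum_mem _ fun p hp => ?_
    rw [← Finset.HasAntidiagonal.mem_antidiagonal.mp hp, pow_add, mul_left_comm]
    exact Ideal.mul_mem_mul (f.2 p.1) (hg p.2)

/-- The fiber cone `F(I) = ⨁ Iⁿ / 𝔪 Iⁿ`, as the quotient of the Rees algebra `⨁ Iⁿ tⁿ` by its
homogeneous ideal `⨁ 𝔪 Iⁿ tⁿ`. -/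
abbrev FiberCone {R : Type*} [CommRing R] [IsLocalRing R] (I : Ideal R) : Type _ :=
  reesAlgebra I ⧸ fiberConeRel I

/-- The homogeneous maximal ideal `F(I)₊ = ⨁_{n ≥ 1} Iⁿ / 𝔪 Iⁿ` of the fiber cone: the image of
the elements of the Rees algebra with zero constant coefficient (it is maximal because
`F(I)₀ = R / 𝔪` is a field). -/
noncomputable def fiberConeIrrelevant {R : Type*} [CommRing R] [IsLocalRing R] (I : Ideal R) :
    Ideal (FiberCone I) :=
  (RingHom.ker (Polynomial.constantCoeff.comp (reesAlgebra I).val.toRingHom)).map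
    (Ideal.Quotient.mk (fiberConeRel I))

/-- `depth F(I)`, the depth of the fiber cone with respect to its homogeneous maximal ideal. -/
noncomputable def fiberConeDepth {R : Type*} [CommRing R] [IsLocalRing R] (I : Ideal R) : ℕ∞ :=
  ringDepth (A := FiberCone I) (fiberConeIrrelevant I)

/-! Write d = e + 1 and let k be the residue field. Since k is infinite and J has no proper
reduction, J is generated by d elements aᵢ (`spanFinrank_eq_of_forall_isReduction`). As R is
Cohen–Macaulay, the aᵢ form a regular, hence quasi-regular, sequence; moreover J ∩ 𝔪I = 𝔪J.
`IsGoodReduction` collects these facts. Let S be the polynomial ring over k in d variables, acting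
on F(I) through Xᵢ ↦ aᵢt, and let N ⊆ F(I) be the S-submodule generated by 1 and the yⱼt, where the
yⱼ minimally generate I modulo J. In degree n + 1, N is the image of JⁿI.

Both N and F(I)/N are presented over S by at most one relation. For N, quasi-regularity makes the
generators independent except for what 𝔪Iⁿ⁺² ∩ Jⁿ⁺¹I contributes beyond 𝔪Jⁿ⁺¹I. This excess comes
from degree 2, where the length hypothesis says that one element c generates it. The quotient F(I)/N
is generated in degree 2 by at most two elements, because Iⁿ⁺² = JⁿI² and λ(I²/JI) ≤ 2. It is
torsion-free, and over a factorial domain the relations between two generators of a torsion-free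
module are multiples of one relation (`exists_presentation_of_two_generators`).

A module with at most one relation over S has depth at least d - 1. Explicitly, the e linear forms
cutting out the line through a point p are regular on it as soon as the relation is zero or has a
component not vanishing at p (`isWeaklyRegular_lineForm`). A general p serves N and F(I)/N together,
and regularity passes to the extension F(I).

The excess and the torsion are controlled by cases. If 𝔪I² ⊆ JI, it suffices that a form with a unit
coefficient is a nonzerodivisor modulo JᵐI. Otherwise I²/JI is uniserial of length 2 with generators
z and xz, and the same fact is applied first to z, then to xz. The argument only needs λ(I²/JI) ≤ 2,
so in (b) it also yields d - 1. -/

section CohenMacaulay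

/-! ### Systems of parameters in Cohen–Macaulay local rings are regular sequences. -/

open RingTheory.Sequence Module Pointwise

variable {R : Type*} [CommRing R] [IsLocalRing R]

/-- `M` admits a weakly regular sequence of length `n` inside the maximal ideal. -/
def HasWeaklyRegularSeq (M : Type*) [AddCommGroup M] [Module R M] (n : ℕ) : Prop :=
  ∃ rs : List R, rs.length = n ∧ (∀ r ∈ rs, r ∈ maximalIdeal R) ∧ IsWeaklyRegular M rs

variable {M : Type*} [AddCommGroup M] [Module R M]

lemma HasWeaklyRegularSeq.exists_cons {n : ℕ} (h : HasWeaklyRegularSeq (R := R) M (n + 1)) :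
    ∃ x ∈ maximalIdeal R, IsSMulRegular M x ∧
      HasWeaklyRegularSeq (R := R) (QuotSMulTop x M) n := by
  obtain ⟨rs, hl, hm, hr⟩ := h
  cases rs with
  | nil => simp at hl
  | cons x rs =>
    rw [isWeaklyRegular_cons_iff] at hr
    exact ⟨x, hm x (by simp), hr.1, rs, by simpa using hl, fun r h => hm r (by simp [h]), hr.2⟩

lemma HasWeaklyRegularSeq.cons {n : ℕ} {x : R} (hx : x ∈ maximalIdeal R) (hr : IsSMulRegular M x)
    (h : HasWeaklyRegularSeq (R := R) (QuotSMulTop x M) n) :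
    HasWeaklyRegularSeq (R := R) M (n + 1) := by
  obtain ⟨rs, hl, hm, h⟩ := h
  refine ⟨x :: rs, by simp [hl], ?_, (isWeaklyRegular_cons_iff M x rs).2 ⟨hr, h⟩⟩
  intro r hr
  rcases List.mem_cons.1 hr with rfl | hr
  exacts [hx, hm r hr]

variable [IsNoetherianRing R] [Module.Finite R M]

lemma HasWeaklyRegularSeq.swap {n : ℕ} {x z : R} (hx : x ∈ maximalIdeal R)
    (hz : z ∈ maximalIdeal R) (hxM : IsSMulRegular M x) (hzM : IsSMulRegular (QuotSMulTop x M) z)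
    (h : HasWeaklyRegularSeq (R := R) (QuotSMulTop z (QuotSMulTop x M)) n) :
    HasWeaklyRegularSeq (R := R) (QuotSMulTop x (QuotSMulTop z M)) n := by
  obtain ⟨rs, hl, hm, h⟩ := h
  have h1 : IsWeaklyRegular M (x :: z :: rs) := by
    simp only [isWeaklyRegular_cons_iff]; exact ⟨hxM, hzM, h⟩
  have h2 := IsLocalRing.isWeaklyRegular_of_perm_of_subset_maximalIdeal h1
    (List.Perm.swap z x rs) (by
      intro r hr
      simp only [List.mem_cons] at hr
      rcases hr with rfl | rfl | hr
      exacts [hx, hz, hm r hr])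
  simp only [isWeaklyRegular_cons_iff] at h2
  exact ⟨rs, hl, hm, h2.2.2⟩

lemma isSMulRegular_quotSMulTop_swap {x z : R} (hx : x ∈ maximalIdeal R)
    (hz : z ∈ maximalIdeal R) (hxM : IsSMulRegular M x) (hzM : IsSMulRegular (QuotSMulTop x M) z) :
    IsSMulRegular (QuotSMulTop z M) x := by
  have h1 : IsWeaklyRegular M [x, z] := by
    simp only [isWeaklyRegular_cons_iff]; exact ⟨hxM, hzM, IsWeaklyRegular.nil _ _⟩
  have h2 := IsLocalRing.isWeaklyRegular_of_perm_of_subset_maximalIdeal h1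
    (List.Perm.swap z x []) (by
      intro r hr
      simp only [List.mem_cons, List.not_mem_nil, or_false] at hr
      rcases hr with rfl | rfl
      exacts [hx, hz])
  simp only [isWeaklyRegular_cons_iff] at h2
  exact h2.2.1

omit [IsNoetherianRing R] [Module.Finite R M] in
lemma eq_zero_of_forall_mem_maximalIdeal_smul_eq_zero {x : R} (hx : x ∈ maximalIdeal R)
    (hr : IsSMulRegular M x) {u : M} (hu : ∀ r ∈ maximalIdeal R, r • u = 0) : u = 0 :=
  hr.right_eq_zero_of_smul (hu x hx)

/-- A zero socle means Hom(R/𝔪, M) = 0, and for finite modules over a Noetherian ring this vanishing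
produces an M-regular element in the annihilator of R/𝔪. -/
lemma exists_isSMulRegular_of_socle_eq_zero
    (h : ∀ u : M, (∀ r ∈ maximalIdeal R, r • u = 0) → u = 0) :
    ∃ x ∈ maximalIdeal R, IsSMulRegular M x := by
  have : Subsingleton ((R ⧸ maximalIdeal R) →ₗ[R] M) := by
    refine subsingleton_of_forall_eq 0 fun f => ?_
    refine Submodule.linearMap_qext _ (LinearMap.ext_ring ?_)
    refine h _ fun r hr => ?_
    rw [← map_smul]
    have : r • (1 : R) ∈ LinearMap.ker (Submodule.mkQ (maximalIdeal R)) := by simpa using hr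
    simp only [LinearMap.comp_apply]
    rw [LinearMap.mem_ker.1 this, map_zero]
  obtain ⟨r, hr, h⟩ := IsSMulRegular.subsingleton_linearMap_iff.1 this
  refine ⟨r, ?_, h⟩
  simpa [Ideal.annihilator_quotient] using hr

omit [IsNoetherianRing R] [Module.Finite R M] in
-- The socles of M/xM and M/yM correspond (both are Ext¹(R/𝔪, M)): a socle class u modulo y gives xu
-- = yv, where v is a socle class modulo x, and v ∈ xM forces u ∈ yM.
lemma socle_quotSMulTop_eq_zero {x y : R} (hxM : IsSMulRegular M x) (hyM : IsSMulRegular M y)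
    (h : ∀ u : QuotSMulTop x M, (∀ r ∈ maximalIdeal R, r • u = 0) → u = 0) (hx : x ∈ maximalIdeal R)
    (u : QuotSMulTop y M) (hu : ∀ r ∈ maximalIdeal R, r • u = 0) : u = 0 := by
  obtain ⟨u, rfl⟩ := Submodule.mkQ_surjective _ u
  have key : ∀ r ∈ maximalIdeal R, ∃ w, r • u = y • w := by
    intro r hr
    have := hu r hr
    rw [← map_smul, Submodule.mkQ_apply, Submodule.Quotient.mk_eq_zero,
      Submodule.mem_smul_pointwise_iff_exists] at this
    obtain ⟨w, -, hw⟩ := this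
    exact ⟨w, hw.symm⟩
  obtain ⟨v, hv⟩ := key x hx
  have hv0 := h (Submodule.mkQ _ v) (by
    intro r hr
    obtain ⟨w, hw⟩ := key r hr
    rw [← map_smul, Submodule.mkQ_apply, Submodule.Quotient.mk_eq_zero,
      Submodule.mem_smul_pointwise_iff_exists]
    refine ⟨w, trivial, hyM ?_⟩
    change y • x • w = y • r • v
    rw [smul_comm y r v, ← hv, smul_comm y x w, ← hw, smul_comm])
  rw [Submodule.mkQ_apply, Submodule.Quotient.mk_eq_zero,
    Submodule.mem_smul_pointwise_iff_exists] at hv0 ⊢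
  obtain ⟨w, -, rfl⟩ := hv0
  refine ⟨w, trivial, hxM ?_⟩
  change x • y • w = x • u
  rw [hv, smul_comm]

/-- Independence of depth from the chosen regular element, by exchange: x starts the given sequence,
y is arbitrary, and an element z regular on M/xM and on M/yM links the two through M/zM, where the
induction hypothesis applies. -/
lemma HasWeaklyRegularSeq.quotSMulTop {n : ℕ} (h : HasWeaklyRegularSeq (R := R) M (n + 1)) {y : R}
    (hy : y ∈ maximalIdeal R) (hyM : IsSMulRegular M y) :
    HasWeaklyRegularSeq (R := R) (QuotSMulTop y M) n := by
  induction n generalizing M y with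
  | zero => exact ⟨[], rfl, by simp, IsWeaklyRegular.nil _ _⟩
  | succ n ih =>
    obtain ⟨x, hx, hxM, h⟩ := h.exists_cons
    obtain ⟨x', hx', hxM', -⟩ := h.exists_cons
    have hsx : ∀ u : QuotSMulTop x M, (∀ r ∈ maximalIdeal R, r • u = 0) → u = 0 :=
      fun u hu => eq_zero_of_forall_mem_maximalIdeal_smul_eq_zero hx' hxM' hu
    have hsy := socle_quotSMulTop_eq_zero hxM hyM hsx hx
    -- An element regular on the product is regular on each of the three factors.
    obtain ⟨z, hz, hzr⟩ := exists_isSMulRegular_of_socle_eq_zero (R := R)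
      (M := M × QuotSMulTop x M × QuotSMulTop y M) (by
        rintro ⟨u, v, w⟩ huvw
        have h1 : u = 0 := eq_zero_of_forall_mem_maximalIdeal_smul_eq_zero hx hxM
          fun r hr => congrArg Prod.fst (huvw r hr)
        have h2 : v = 0 := hsx v fun r hr => congrArg (fun t => t.2.1) (huvw r hr)
        have h3 : w = 0 := hsy w fun r hr => congrArg (fun t => t.2.2) (huvw r hr)
        rw [h1, h2, h3]
        rfl)
    have hzM : IsSMulRegular M z := fun u v huv => by
      have := @hzr (u, 0, 0) (v, 0, 0) (by
        change (z • u, z • 0, z • 0) = (z • v, z • 0, z • 0)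
        rw [show z • u = z • v from huv])
      simpa using this
    have hzx : IsSMulRegular (QuotSMulTop x M) z := fun u v huv => by
      have := @hzr (0, u, 0) (0, v, 0) (by
        change (z • 0, z • u, z • 0) = (z • 0, z • v, z • 0)
        rw [show z • u = z • v from huv])
      simpa using this
    have hzy : IsSMulRegular (QuotSMulTop y M) z := fun u v huv => by
      have := @hzr (0, 0, u) (0, 0, v) (by
        change (z • 0, z • 0, z • u) = (z • 0, z • 0, z • v)
        rw [show z • u = z • v from huv])
      simpa using this
    have h1 := HasWeaklyRegularSeq.swap hx hz hxM hzx (ih h hz hzx)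
    have h2 := h1.cons hx (isSMulRegular_quotSMulTop_swap hx hz hxM hzx)
    have hyz := isSMulRegular_quotSMulTop_swap hy hz hyM hzy
    exact (HasWeaklyRegularSeq.swap hz hy hzM hyz (ih h2 hy hyz)).cons hz hzy

/-- Depth is at most dim R/P for every associated prime P. For a regular x, some u killed by P
survives in M/xM, and its annihilator there lies in an associated prime Q of M/xM containing P and
x. Since x ∉ P, the dimension of R/Q is at most dim R/P - 1. -/
lemma HasWeaklyRegularSeq.le_supportDim {n : ℕ} (h : HasWeaklyRegularSeq (R := R) M n)
    {P : Ideal R} (hP : P ∈ associatedPrimes R M) : (n : WithBot ℕ∞) ≤ supportDim R (R ⧸ P) := by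
  induction n generalizing M P with
  | zero =>
    have := hP.isPrime
    have : Nontrivial (R ⧸ P) := Ideal.Quotient.nontrivial_iff.2 this.ne_top
    exact Order.krullDim_nonneg_iff.2 (Module.nonempty_support_of_nontrivial (R := R)).to_subtype
  | succ n ih =>
    obtain ⟨x, hx, hxM, h⟩ := h.exists_cons
    have hprime := hP.isPrime
    obtain ⟨-, v, hv⟩ := isAssociatedPrime_iff.1 hP
    have hxP : x ∉ P := by
      intro hxP
      rw [hv, Submodule.mem_colon_singleton] at hxP
      have : v = 0 := hxM.right_eq_zero_of_smul (by simpa using hxP)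
      subst this
      exact hprime.ne_top (by rw [hv]; simp)
    let N : Submodule R M := Submodule.torsionBySet R M P
    -- If N ⊆ xM then N = xN because x is regular, so N = 0 by Nakayama; but v ∈ N is nonzero.
    obtain ⟨u, huN, hux⟩ : ∃ u ∈ N, u ∉ x • (⊤ : Submodule R M) := by
      by_contra! hcon
      have hN : N ≤ Ideal.span {x} • N := by
        intro u hu
        obtain ⟨w, -, rfl⟩ := (Submodule.mem_smul_pointwise_iff_exists _ _ _).1 (hcon u hu)
        refine Submodule.smul_mem_smul (Ideal.mem_span_singleton_self x) ?_
        rw [Submodule.mem_torsionBySet_iff] at hu ⊢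
        intro p
        refine hxM ?_
        change x • _ • w = x • (0 : M)
        rw [smul_comm, smul_zero]
        exact hu p
      have hbot := Submodule.eq_bot_of_le_smul_of_le_jacobson_bot _ _
        (IsNoetherian.noetherian N) hN (by
          rw [IsLocalRing.jacobson_eq_maximalIdeal _ bot_ne_top, Ideal.span_le]
          simpa using hx)
      have hvN : v ∈ N := by
        rw [Submodule.mem_torsionBySet_iff]
        rintro ⟨p, hp⟩
        rw [SetLike.mem_coe, hv, Submodule.mem_colon_singleton] at hp
        simpa using hp
      rw [hbot, Submodule.mem_bot] at hvN
      subst hvN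
      exact hprime.ne_top (by rw [hv]; simp)
    obtain ⟨Q, hQ, hle⟩ := exists_le_isAssociatedPrime_of_isNoetherianRing R
      (Submodule.Quotient.mk u : QuotSMulTop x M) (by
        rwa [Ne, Submodule.Quotient.mk_eq_zero])
    have hPQ : P ≤ Q := fun p hp => hle (by
      rw [Submodule.mem_colon_singleton, Submodule.mem_bot, ← Submodule.Quotient.mk_smul]
      rw [Submodule.mem_torsionBySet_iff] at huN
      rw [huN ⟨p, hp⟩, Submodule.Quotient.mk_zero])
    have hxQ : x ∈ Q := hle (by
      rw [Submodule.mem_colon_singleton, Submodule.mem_bot, ← Submodule.Quotient.mk_smul,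
        Submodule.Quotient.mk_eq_zero]
      exact Submodule.smul_mem_pointwise_smul _ _ _ trivial)
    have hreg : IsSMulRegular (R ⧸ P) x := by
      rw [isSMulRegular_quotient_iff_mem_of_smul_mem]
      intro r hr
      exact (hprime.mem_or_mem hr).resolve_left hxP
    rw [← supportDim_quotSMulTop_succ_eq_supportDim hreg hx]
    have h1 := ih h hQ
    let f : QuotSMulTop x (R ⧸ P) →ₗ[R] R ⧸ Q :=
      Submodule.liftQ _ (Submodule.factor hPQ) (by
        intro w hw
        obtain ⟨w, -, rfl⟩ := (Submodule.mem_smul_pointwise_iff_exists _ _ _).1 hw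
        obtain ⟨w, rfl⟩ := Submodule.mkQ_surjective _ w
        change (Submodule.Quotient.mk (x • w) : R ⧸ Q) = 0
        rw [Submodule.Quotient.mk_eq_zero]
        exact Q.mul_mem_right _ hxQ)
    have hf : Function.Surjective f := by
      intro w
      obtain ⟨w, rfl⟩ := Submodule.mkQ_surjective _ w
      exact ⟨Submodule.mkQ _ (Submodule.mkQ _ w), rfl⟩
    have h2 := supportDim_le_of_surjective f hf
    push_cast
    gcongr
    exact h1.trans h2

lemma supportDim_le_of_quotient_ofList {as : List R} (hm : ∀ a ∈ as, a ∈ maximalIdeal R)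
    (h : supportDim R (M ⧸ (Ideal.ofList as • ⊤ : Submodule R M)) ≤ 0) :
    supportDim R M ≤ as.length := by
  induction as generalizing M with
  | nil =>
    refine le_trans (le_of_eq ?_) h
    refine (supportDim_eq_of_equiv (Submodule.quotEquivOfEqBot _ ?_)).symm
    simp
  | cons a as ih =>
    refine (supportDim_le_supportDim_quotSMulTop_succ (hm a (by simp))).trans ?_
    rw [supportDim_eq_of_equiv
      (Submodule.quotOfListConsSMulTopEquivQuotSMulTopInner M a as)] at h
    have := ih (fun b hb => hm b (by simp [hb])) h
    push_cast [List.length_cons]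
    gcongr

/-- The first element a avoids every associated prime P: if a ∈ P then dim R/P ≤ dim M/aM, which is
at most the number of remaining elements, while depth forces dim R/P to be larger. The depth then
drops by one and the induction continues on M/aM. -/
lemma HasWeaklyRegularSeq.isWeaklyRegular {as : List R} (hm : ∀ a ∈ as, a ∈ maximalIdeal R)
    (h : HasWeaklyRegularSeq (R := R) M as.length)
    (hd : supportDim R (M ⧸ (Ideal.ofList as • ⊤ : Submodule R M)) ≤ 0) :
    IsWeaklyRegular M as := by
  induction as generalizing M with
  | nil => exact IsWeaklyRegular.nil _ _
  | cons a as ih =>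
    rw [supportDim_eq_of_equiv
      (Submodule.quotOfListConsSMulTopEquivQuotSMulTopInner M a as)] at hd
    have hm' := fun b hb => hm b (List.mem_cons_of_mem a hb)
    have hdim := supportDim_le_of_quotient_ofList hm' hd
    have hreg : IsSMulRegular M a := by
      by_contra hcon
      have hmem : a ∈ ⋃ p ∈ associatedPrimes R M, (p : Set R) := by
        rw [biUnion_associatedPrimes_eq_compl_regular]; exact hcon
      simp only [Set.mem_iUnion] at hmem
      obtain ⟨P, hP, haP⟩ := hmem
      have h1 := h.le_supportDim hP
      have h2 : supportDim R (R ⧸ P) ≤ supportDim R (QuotSMulTop a M) := by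
        refine Order.krullDim_le_of_strictMono (fun q => ⟨q.1, ?_⟩) (fun {_ _} lt => lt)
        have hq := q.2
        rw [Module.mem_support_iff_of_finite, Ideal.annihilator_quotient] at hq
        rw [Module.support_quotSMulTop]
        refine ⟨?_, by simpa using hq haP⟩
        rw [Module.mem_support_iff_of_finite]
        refine le_trans ?_ hq
        obtain ⟨-, v, hv⟩ := isAssociatedPrime_iff.1 hP
        intro r hr
        rw [hv, Submodule.mem_colon_singleton, Submodule.mem_bot]
        exact Module.mem_annihilator.1 hr v
      have h3 := h1.trans (h2.trans hdim)
      rw [List.length_cons] at h3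
      have h4 : as.length + 1 ≤ as.length := by exact_mod_cast h3
      omega
    rw [isWeaklyRegular_cons_iff]
    exact ⟨hreg, ih hm' (h.quotSMulTop (hm a (by simp)) hreg) hd⟩

/-- In a Cohen-Macaulay local ring of dimension `d`, any `d` elements generating an ideal primary
to the maximal ideal form a regular sequence. -/
theorem IsCohenMacaulayLocal.isWeaklyRegular (hCM : IsCohenMacaulayLocal R) {d : ℕ}
    (hdim : ringKrullDim R = d) {as : List R} (hl : as.length = d)
    (hrad : (Ideal.ofList as).radical = maximalIdeal R) : IsWeaklyRegular R as := by
  have hm : ∀ a ∈ as, a ∈ maximalIdeal R := fun a ha => by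
    rw [← hrad]; exact Ideal.le_radical (Ideal.subset_span ha)
  refine HasWeaklyRegularSeq.isWeaklyRegular hm ?_ ?_
  · rw [hl]
    have h1 : ringDepth (maximalIdeal R) = d := by
      have := hCM.2
      rw [hdim] at this
      exact_mod_cast this
    by_contra hcon
    -- The supremum is attained: a regular sequence of length at least d could be truncated to d, so
    -- otherwise all lengths are below d. The case d = 0 is excluded separately since d - 1
    -- truncates.
    have h2 : ringDepth (maximalIdeal R) ≤ ((d - 1 : ℕ) : ℕ∞) := by
      refine iSup₂_le fun rs hrs => ?_
      have : rs.length < d := by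
        by_contra! hlt
        refine hcon ⟨rs.take d, by simpa using hlt, fun r hr => hrs.1 r (List.mem_of_mem_take hr),
          ?_⟩
        have := hrs.2.1
        rw [← List.take_append_drop d rs, isWeaklyRegular_append_iff] at this
        exact this.1
      exact_mod_cast (by omega : rs.length ≤ d - 1)
    have hd : d ≠ 0 := by
      rintro rfl
      exact hcon ⟨[], rfl, by simp, IsWeaklyRegular.nil _ _⟩
    rw [h1] at h2
    have : d ≤ d - 1 := by exact_mod_cast h2
    omega
  · have e : (Ideal.ofList as • ⊤ : Ideal R) = Ideal.ofList as := by simp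
    rw [e]
    have key : ∀ p : Module.support R (R ⧸ Ideal.ofList as), p.1.asIdeal = maximalIdeal R := by
      intro p
      have hp := p.2
      rw [Module.mem_support_iff_of_finite, Ideal.annihilator_quotient] at hp
      refine le_antisymm (le_maximalIdeal p.1.2.ne_top) ?_
      rw [← hrad]
      exact p.1.2.radical_le_iff.2 hp
    have : Subsingleton (Module.support R (R ⧸ Ideal.ofList as)) :=
      ⟨fun p q => Subtype.ext (PrimeSpectrum.ext ((key p).trans (key q).symm))⟩
    exact Order.krullDim_nonpos_of_subsingleton

end CohenMacaulay

/-! ### Regular sequences are quasi-regular. -/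

section QuasiRegular

open MvPolynomial

variable {R : Type*} [CommRing R] {ι : Type*}

lemma MvPolynomial.IsHomogeneous.degree_eq {n : ℕ} {σ : MvPolynomial ι R} (hσ : σ.IsHomogeneous n)
    {m : ι →₀ ℕ} (hm : coeff m σ ≠ 0) : m.degree = n := by
  rw [Finsupp.degree_eq_weight_one]; exact hσ hm

lemma Ideal.finsupp_prod_pow_mem_pow {a : ι → R} {J : Ideal R} (m : ι →₀ ℕ)
    (ha : ∀ i ∈ m.support, a i ∈ J) : ∏ i ∈ m.support, a i ^ m i ∈ J ^ m.degree := by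
  rw [Finsupp.degree_apply, ← Finset.prod_pow_eq_pow_sum]
  exact Ideal.prod_mem_prod fun i hi => Ideal.pow_mem_pow (ha i hi) _

lemma MvPolynomial.IsHomogeneous.eval_mem_pow_mul {a : ι → R} {J A : Ideal R}
    (ha : ∀ i, a i ∈ J) {n : ℕ} {σ : MvPolynomial ι R} (hσ : σ.IsHomogeneous n)
    (hc : ∀ m, coeff m σ ∈ A) :
    eval a σ ∈ J ^ n * A := by
  rw [eval_eq]
  refine Ideal.sum_mem _ fun m hm => ?_
  rw [mul_comm (J ^ n)]
  refine Ideal.mul_mem_mul (hc m) ?_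
  rw [← hσ.degree_eq (mem_support_iff.1 hm)]
  exact Ideal.finsupp_prod_pow_mem_pow m fun i _ => ha i

lemma MvPolynomial.IsHomogeneous.eval_mem_pow {a : ι → R} {J : Ideal R} (ha : ∀ i, a i ∈ J)
    {n : ℕ} {σ : MvPolynomial ι R} (hσ : σ.IsHomogeneous n) : eval a σ ∈ J ^ n := by
  simpa using hσ.eval_mem_pow_mul (A := ⊤) ha (fun _ => trivial)

lemma exists_isHomogeneous_of_mem_span_pow_mul (a : ι → R) (s : Set ι) (A : Ideal R) {n : ℕ} {u : R}
    (hu : u ∈ Ideal.span (a '' s) ^ n * A) :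
    ∃ σ : MvPolynomial ι R, σ.IsHomogeneous n ∧ (∀ m, coeff m σ ≠ 0 → (m.support : Set ι) ⊆ s) ∧
      (∀ m, coeff m σ ∈ A) ∧ eval a σ = u := by
  classical
  induction hu using Submodule.mul_induction_on' with
  | mem_mul_mem v hv c hc =>
    have hr : a '' s = Set.range (fun i : s => a i) := by
      ext; simp
    rw [hr, Ideal.mem_span_pow_iff_exists_isHomogeneous] at hv
    obtain ⟨p, hp, rfl⟩ := hv
    refine ⟨C c * rename Subtype.val p, ?_, ?_, ?_, ?_⟩
    · simpa using (isHomogeneous_C ι c).mul (hp.rename_isHomogeneous (f := Subtype.val))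
    · intro m hm
      rw [coeff_C_mul] at hm
      obtain ⟨m', rfl, -⟩ := coeff_rename_ne_zero _ _ _ (right_ne_zero_of_mul hm)
      intro i hi
      have := Finsupp.mapDomain_support hi
      simp only [Finset.mem_image] at this
      obtain ⟨j, -, rfl⟩ := this
      exact j.2
    · intro m
      rw [coeff_C_mul]
      exact A.mul_mem_right _ hc
    · rw [map_mul, eval_C, eval_rename, mul_comm]; rfl
  | add x _ y _ hx hy =>
    obtain ⟨σ, h1, h2, h3, rfl⟩ := hx
    obtain ⟨τ, h1', h2', h3', rfl⟩ := hy
    refine ⟨σ + τ, h1.add h1', fun m hm => ?_, fun m => ?_, by simp⟩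
    · by_cases h : coeff m σ = 0
      · exact h2' m (by simpa [h] using hm)
      · exact h2 m h
    · rw [coeff_add]; exact A.add_mem (h3 m) (h3' m)

/-- The elements `a i`, `i ∈ s`, form a quasi-regular family: a form of degree `n` in them which
lies in the `(n + 1)`-st power of the ideal they generate has its coefficients in that ideal. -/
def IsQuasiRegularOn (a : ι → R) (s : Set ι) : Prop :=
  ∀ (n : ℕ) (σ : MvPolynomial ι R), σ.IsHomogeneous n →
    (∀ m, coeff m σ ≠ 0 → (m.support : Set ι) ⊆ s) →
    eval a σ ∈ Ideal.span (a '' s) ^ (n + 1) → ∀ m, coeff m σ ∈ Ideal.span (a '' s)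

variable {a : ι → R}

lemma isQuasiRegularOn_empty : IsQuasiRegularOn a ∅ := by
  classical
  intro n σ _ hs he m
  simp only [Set.image_empty, Ideal.span_empty] at he ⊢
  rw [Ideal.mem_bot]
  have hσ : σ = C (coeff 0 σ) := by
    ext m
    rw [coeff_C]
    split_ifs with h
    · rw [h]
    · by_contra h'
      have := hs m h'
      simp at this
      exact h this.symm
  rw [hσ, eval_C, ← Ideal.zero_eq_bot, zero_pow (by omega), Ideal.zero_eq_bot, Ideal.mem_bot] at he
  rw [hσ, he]
  simp

/-- Climb the powers of the ideal: if u is the value of a form of degree t < m, then x times that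
form has its value in the next power, so quasi-regularity puts x times each coefficient in the
ideal, and x can be cancelled. -/
lemma IsQuasiRegularOn.mem_pow_of_mul_mem_pow {s : Set ι} (h : IsQuasiRegularOn a s) {x : R}
    (hx : ∀ r, x * r ∈ Ideal.span (a '' s) → r ∈ Ideal.span (a '' s)) {m : ℕ} {u : R}
    (hu : x * u ∈ Ideal.span (a '' s) ^ m) : u ∈ Ideal.span (a '' s) ^ m := by
  classical
  suffices ∀ t ≤ m, u ∈ Ideal.span (a '' s) ^ t from this m le_rfl
  intro t
  induction t with
  | zero => simp
  | succ t ih =>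
    intro ht
    have := ih (by omega)
    rw [← Ideal.mul_top (_ ^ t)] at this
    obtain ⟨τ, h1, h2, -, rfl⟩ := exists_isHomogeneous_of_mem_span_pow_mul a s _ this
    have hc := h t (C x * τ) (by simpa using (isHomogeneous_C ι x).mul h1)
      (fun m hm => h2 m (by rw [coeff_C_mul] at hm; exact right_ne_zero_of_mul hm))
      (by simpa using Ideal.pow_le_pow_right ht hu)
    have h3 : ∀ i : s, a i ∈ Ideal.span (a '' s) := fun i => Ideal.subset_span ⟨i, i.2, rfl⟩
    rw [pow_succ]
    rw [eval_eq]
    refine Ideal.sum_mem _ fun M hM => ?_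
    have h4 := h2 M (mem_support_iff.1 hM)
    rw [mul_comm (_ ^ t)]
    refine Ideal.mul_mem_mul (hx _ (by simpa [coeff_C_mul] using hc M)) ?_
    rw [← h1.degree_eq (mem_support_iff.1 hM)]
    exact Ideal.finsupp_prod_pow_mem_pow M fun i hi => h3 ⟨i, h4 hi⟩

/-- Adding one element that is regular modulo the previous ones keeps quasi-regularity. The
induction is on the degree, after reduction to forms that vanish at `a`. -/
lemma IsQuasiRegularOn.insert {s : Set ι} (h : IsQuasiRegularOn a s) {j : ι}
    (hx : ∀ r, a j * r ∈ Ideal.span (a '' s) → r ∈ Ideal.span (a '' s)) :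
    IsQuasiRegularOn a (insert j s) := by
  classical
  set K := Ideal.span (a '' s) with hK
  set L := Ideal.span (a '' (Insert.insert j s)) with hL
  have hKL : K ≤ L := Ideal.span_mono (Set.image_mono (Set.subset_insert _ _))
  have hjL : a j ∈ L := Ideal.subset_span ⟨j, Set.mem_insert _ _, rfl⟩
  -- it is enough to treat forms that vanish at `a`
  have reduce : ∀ n, (∀ σ : MvPolynomial ι R, σ.IsHomogeneous n →
      (∀ m, coeff m σ ≠ 0 → (m.support : Set ι) ⊆ Insert.insert j s) →
      eval a σ = 0 → ∀ m, coeff m σ ∈ L) → ∀ σ : MvPolynomial ι R, σ.IsHomogeneous n →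
      (∀ m, coeff m σ ≠ 0 → (m.support : Set ι) ⊆ Insert.insert j s) →
      eval a σ ∈ L ^ (n + 1) → ∀ m, coeff m σ ∈ L := by
    intro n H σ h1 h2 h3 m
    rw [pow_succ] at h3
    obtain ⟨τ, h1', h2', h3', h4'⟩ := exists_isHomogeneous_of_mem_span_pow_mul a _ _ h3
    have := H (σ - τ) (h1.sub h1') (fun m hm => by
      by_cases h0 : coeff m σ = 0
      · exact h2' m (by intro h; simp [h0, h] at hm)
      · exact h2 m h0) (by simp [h4']) m
    simpa using L.add_mem this (h3' m)
  intro n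
  refine reduce n ?_
  induction n with
  | zero =>
    intro σ h1 _ h3 m
    rw [← totalDegree_zero_iff_isHomogeneous, totalDegree_eq_zero_iff_eq_C] at h1
    rw [h1, eval_C] at h3
    rw [h1, h3]
    simp
  | succ n ih =>
    intro σ h1 h2 h3
    -- Write σ = Xⱼρ + τ with τ free of Xⱼ. Since σ vanishes at `a`, the product of `a j` with ρ(a)
    -- lies in K^(n+1), so ρ(a) does too.
    have hdm := divMonomial_add_modMonomial_single σ j
    set ρ := divMonomial σ (Finsupp.single j 1) with hρ
    set τ := modMonomial σ (Finsupp.single j 1) with hτ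
    have hρh : ρ.IsHomogeneous n := by
      intro m hm
      rw [coeff_divMonomial] at hm
      have := h1.degree_eq hm
      simp only [map_add, Finsupp.degree_single] at this
      have h4 : m.degree = n := by omega
      rwa [Finsupp.degree_eq_weight_one] at h4
    have hτc : ∀ m, coeff m τ ≠ 0 → coeff m σ ≠ 0 ∧ m j = 0 := by
      intro m hm
      by_cases hle : Finsupp.single j 1 ≤ m
      · rw [coeff_modMonomial_of_le _ hle] at hm; exact absurd rfl hm
      · rw [coeff_modMonomial_of_not_le _ hle] at hm
        refine ⟨hm, ?_⟩
        rw [Finsupp.single_le_iff] at hle; omega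
    have hτh : τ.IsHomogeneous (n + 1) := fun m hm => h1 (hτc m hm).1
    have hτs : ∀ m, coeff m τ ≠ 0 → (m.support : Set ι) ⊆ s := by
      intro m hm i hi
      refine (h2 m (hτc m hm).1 hi).resolve_left ?_
      rintro rfl
      exact (Finsupp.mem_support_iff.1 hi) (hτc m hm).2
    have hev : a j * eval a ρ + eval a τ = 0 := by
      rw [← h3, ← hdm]; simp
    have hτK : eval a τ ∈ K ^ (n + 1) := by
      rw [eval_eq]
      refine Ideal.sum_mem _ fun M hM => Ideal.mul_mem_left _ _ ?_
      have h4 := hτs M (mem_support_iff.1 hM)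
      rw [← hτh.degree_eq (mem_support_iff.1 hM)]
      exact Ideal.finsupp_prod_pow_mem_pow M fun i hi => Ideal.subset_span ⟨i, h4 hi, rfl⟩
    have hρK : eval a ρ ∈ K ^ (n + 1) := by
      refine h.mem_pow_of_mul_mem_pow hx ?_
      rw [eq_neg_of_add_eq_zero_left hev]
      exact neg_mem hτK
    have hρL : ∀ m, coeff m ρ ∈ L := by
      refine reduce n ih ρ hρh ?_ (Ideal.pow_right_mono hKL _ hρK)
      intro m hm i hi
      rw [coeff_divMonomial] at hm
      refine h2 _ hm ?_
      simp only [Finset.mem_coe, Finsupp.mem_support_iff, Finsupp.add_apply] at hi ⊢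
      omega
    rw [← Ideal.mul_top (_ ^ _)] at hρK
    obtain ⟨ψ, p1, p2, -, p4⟩ := exists_isHomogeneous_of_mem_span_pow_mul a s _ hρK
    -- Replacing Xⱼρ by aⱼψ, where ψ only involves the old variables and has the same value as ρ,
    -- gives a form in the old variables vanishing at `a`.
    have hτL : ∀ m, coeff m τ ∈ L := by
      intro m
      have := h (n + 1) (τ + C (a j) * ψ)
        (hτh.add (by simpa using (isHomogeneous_C ι (a j)).mul p1)) (fun m hm => by
          by_cases h0 : coeff m τ = 0
          · refine p2 m ?_
            rw [coeff_add, h0, zero_add, coeff_C_mul] at hm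
            exact right_ne_zero_of_mul hm
          · exact hτs m h0) (by
          rw [map_add, map_mul, eval_C, p4, add_comm (eval a τ), hev]; exact zero_mem _) m
      rw [coeff_add, coeff_C_mul] at this
      have h5 := L.sub_mem (hKL this) (L.mul_mem_right (coeff m ψ) hjL)
      simpa using h5
    intro m
    by_cases hle : Finsupp.single j 1 ≤ m
    · have := hρL (m - Finsupp.single j 1)
      rwa [coeff_divMonomial, add_tsub_cancel_of_le hle] at this
    · have := hτL m
      rwa [coeff_modMonomial_of_not_le _ hle] at this

lemma Ideal.ofList_take_ofFn {d : ℕ} (a : Fin d → R) (i : ℕ) :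
    Ideal.ofList ((List.ofFn a).take i) = Ideal.span (a '' {j : Fin d | (j : ℕ) < i}) := by
  refine congrArg Ideal.span (Set.ext fun r => ?_)
  change r ∈ (List.ofFn a).take i ↔ _
  simp only [List.mem_take_iff_getElem, List.length_ofFn, List.getElem_ofFn]
  constructor
  · rintro ⟨j, hj, rfl⟩
    exact ⟨⟨j, by omega⟩, show j < i by omega, rfl⟩
  · rintro ⟨j, hj, rfl⟩
    have : (j : ℕ) < i := hj
    exact ⟨j, by omega, rfl⟩

/-- A weakly regular sequence is quasi-regular. -/
theorem isQuasiRegularOn_univ_of_isWeaklyRegular {d : ℕ} {a : Fin d → R}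
    (h : RingTheory.Sequence.IsWeaklyRegular R (List.ofFn a)) : IsQuasiRegularOn a Set.univ := by
  suffices ∀ i ≤ d, IsQuasiRegularOn a {j : Fin d | (j : ℕ) < i} by
    have h1 := this d le_rfl
    convert! h1 using 1
    ext j; simp
  intro i
  induction i with
  | zero =>
    intro _
    convert! isQuasiRegularOn_empty (a := a)
    ext; simp
  | succ i ih =>
    intro hi
    have e : {j : Fin d | (j : ℕ) < i + 1} = insert ⟨i, hi⟩ {j : Fin d | (j : ℕ) < i} := by
      ext j; simp [Fin.ext_iff]; omega
    rw [e]
    refine (ih (by omega)).insert ?_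
    have h1 := h.regular_mod_prev i (by simpa using hi)
    rw [isSMulRegular_quotient_iff_mem_of_smul_mem] at h1
    rw [smul_eq_mul, Ideal.mul_top, Ideal.ofList_take_ofFn] at h1
    intro r hr
    exact h1 r (by simpa using hr)

end QuasiRegular

/-! ### Forms with a unit coefficient are nonzerodivisors modulo the ideals JᵐA. -/

section Forms

open MvPolynomial

variable {R : Type*} [CommRing R] {d : ℕ}

/-- Over a Noetherian local ring, multiplication by a polynomial with a unit coefficient detects
polynomials with coefficients in a given ideal. -/
lemma coeff_mem_of_coeff_mul_mem [IsLocalRing R] [IsNoetherianRing R] {A : Ideal R}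
    {σ ψ : MvPolynomial (Fin d) R} (hσ : ∃ m, coeff m σ ∉ maximalIdeal R)
    (h : ∀ m, coeff m (σ * ψ) ∈ A) : ∀ m, coeff m ψ ∈ A := by
  classical
  set B : Ideal R := Ideal.span (Set.range fun m => coeff m ψ) with hB
  have hcB : ∀ m, coeff m ψ ∈ B := fun m => Ideal.subset_span ⟨m, rfl⟩
  have key : ∀ m, coeff m ψ ∈ A ⊔ maximalIdeal R * B := by
    -- Gauss-lemma argument: M is the lex-largest exponent at which σ has a unit coefficient, N the
    -- lex-largest at which ψ has a coefficient outside A + 𝔪B. In degree M + N every other product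
    -- lies in A + 𝔪B. Nakayama then removes 𝔪B.
    by_contra! hcon
    let o := MonomialOrder.lex (σ := Fin d)
    obtain ⟨M, hM, hMmax⟩ := Finset.exists_max_image
      (σ.support.filter fun m => coeff m σ ∉ maximalIdeal R) o.toSyn (by
        obtain ⟨m, hm⟩ := hσ
        refine ⟨m, Finset.mem_filter.2 ⟨mem_support_iff.2 fun h0 => hm ?_, hm⟩⟩
        rw [h0]; exact zero_mem _)
    obtain ⟨N, hN, hNmax⟩ := Finset.exists_max_image
      (ψ.support.filter fun m => coeff m ψ ∉ A ⊔ maximalIdeal R * B) o.toSyn (by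
        obtain ⟨m, hm⟩ := hcon
        refine ⟨m, Finset.mem_filter.2 ⟨mem_support_iff.2 fun h0 => hm ?_, hm⟩⟩
        rw [h0]; exact zero_mem _)
    simp only [Finset.mem_filter, mem_support_iff] at hM hN hMmax hNmax
    have h1 := h (M + N)
    rw [coeff_mul, ← Finset.add_sum_erase _ _
      (Finset.HasAntidiagonal.mem_antidiagonal (a := (M, N)).2 rfl)] at h1
    have h2 : ∑ x ∈ (Finset.HasAntidiagonal.antidiagonal (M + N)).erase (M, N), coeff x.1 σ * coeff x.2 ψ ∈
        A ⊔ maximalIdeal R * B := by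
      refine Ideal.sum_mem _ fun x hx => ?_
      obtain ⟨hne, hadd⟩ := Finset.mem_erase.1 hx
      rw [Finset.HasAntidiagonal.mem_antidiagonal] at hadd
      by_cases h3 : coeff x.1 σ ∈ maximalIdeal R
      · exact Ideal.mem_sup_right (Ideal.mul_mem_mul h3 (hcB _))
      by_cases h4 : coeff x.2 ψ ∈ A ⊔ maximalIdeal R * B
      · exact Ideal.mul_mem_left _ _ h4
      exfalso
      have h5 := hMmax x.1 ⟨fun h0 => h3 (by rw [h0]; exact zero_mem _), h3⟩
      have h6 := hNmax x.2 ⟨fun h0 => h4 (by rw [h0]; exact zero_mem _), h4⟩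
      have h7 : o.toSyn x.1 + o.toSyn x.2 = o.toSyn M + o.toSyn N := by
        rw [← map_add, ← map_add, hadd]
      have h8 : o.toSyn x.1 = o.toSyn M := by
        refine le_antisymm h5 (not_lt.1 fun hlt => ?_)
        exact absurd h7 (add_lt_add_of_lt_of_le hlt h6).ne
      have h9 : x.1 = M := o.toSyn.injective h8
      have h10 : x.2 = N := by rw [h9] at hadd; exact add_left_cancel hadd
      exact hne (Prod.ext h9 h10)
    have h3 := (Ideal.add_mem_iff_left _ h2).1 (Ideal.mem_sup_left h1)
    have hu : IsUnit (coeff M σ) := by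
      by_contra hu; exact hM.2 ((mem_maximalIdeal _).2 hu)
    exact hN.2 ((Ideal.unit_mul_mem_iff_mem _ hu).1 h3)
  have hBA : B ≤ A := by
    refine Submodule.le_of_le_smul_of_le_jacobson_bot (I := maximalIdeal R)
      (IsNoetherian.noetherian B) ?_ ?_
    · rw [IsLocalRing.jacobson_eq_maximalIdeal _ bot_ne_top]
    · rw [hB, Ideal.span_le]
      rintro _ ⟨m, rfl⟩
      exact key m
  exact fun m => hBA (hcB m)

variable {a : Fin d → R} {J : Ideal R}

lemma exists_isHomogeneous_of_mem_pow_mul (hJ : Ideal.span (Set.range a) = J) (A : Ideal R) {n : ℕ}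
    {u : R} (hu : u ∈ J ^ n * A) :
    ∃ σ : MvPolynomial (Fin d) R, σ.IsHomogeneous n ∧ (∀ m, coeff m σ ∈ A) ∧ eval a σ = u := by
  rw [← hJ, ← Set.image_univ] at hu
  obtain ⟨σ, h1, -, h3, h4⟩ := exists_isHomogeneous_of_mem_span_pow_mul a _ _ hu
  exact ⟨σ, h1, h3, h4⟩

lemma exists_isHomogeneous_of_mem_pow (hJ : Ideal.span (Set.range a) = J) {n : ℕ}
    {u : R} (hu : u ∈ J ^ n) :
    ∃ σ : MvPolynomial (Fin d) R, σ.IsHomogeneous n ∧ eval a σ = u := by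
  rw [← Ideal.mul_top (_ ^ n)] at hu
  obtain ⟨σ, h1, -, h3⟩ := exists_isHomogeneous_of_mem_pow_mul hJ _ hu
  exact ⟨σ, h1, h3⟩

/-- Subtract a form with coefficients in A and the same value; the difference vanishes at `a`, so
its coefficients lie in J ⊆ A. -/
lemma IsQuasiRegularOn.coeff_mem (h : IsQuasiRegularOn a Set.univ)
    (hJ : Ideal.span (Set.range a) = J) {A : Ideal R} (hA : J ≤ A) {n : ℕ}
    {σ : MvPolynomial (Fin d) R} (hσ : σ.IsHomogeneous n) (he : eval a σ ∈ J ^ n * A) (m) :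
    coeff m σ ∈ A := by
  obtain ⟨τ, h1, h2, h3⟩ := exists_isHomogeneous_of_mem_pow_mul hJ A he
  have := h n (σ - τ) (hσ.sub h1) (fun _ _ => Set.subset_univ _) (by simp [h3]) m
  rw [Set.image_univ, hJ] at this
  simpa using A.add_mem (hA this) (h2 m)

/-- Over a Noetherian local ring, a form with a unit coefficient in a quasi-regular family is a
nonzerodivisor modulo the ideals `J ^ m * A`. -/
lemma IsQuasiRegularOn.mem_of_eval_mul_mem [IsLocalRing R] [IsNoetherianRing R]
    (h : IsQuasiRegularOn a Set.univ)
    (hJ : Ideal.span (Set.range a) = J) {A : Ideal R} (hA : J ≤ A) {k m : ℕ}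
    {σ : MvPolynomial (Fin d) R} (hσ : σ.IsHomogeneous k) (hc : ∃ m, coeff m σ ∉ maximalIdeal R)
    {u : R} (hu : eval a σ * u ∈ J ^ (m + k) * A) : u ∈ J ^ m * A := by
  have haJ : ∀ i, a i ∈ J := fun i => by rw [← hJ]; exact Ideal.subset_span ⟨i, rfl⟩
  -- First u is pushed into Jᵐ one power at a time; only the last step uses A.
  have h1 : ∀ t ≤ m, u ∈ J ^ t := by
    intro t
    induction t with
    | zero => simp
    | succ t ih =>
      intro ht
      obtain ⟨τ, h1, rfl⟩ := exists_isHomogeneous_of_mem_pow hJ (ih (by omega))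
      rw [pow_succ]
      refine h1.eval_mem_pow_mul haJ (coeff_mem_of_coeff_mul_mem hc ?_)
      refine h.coeff_mem hJ le_rfl (hσ.mul h1) ?_
      rw [map_mul, ← pow_succ]
      exact Ideal.pow_le_pow_right (show k + t + 1 ≤ m + k by omega) (Ideal.mul_le_left hu)
  obtain ⟨τ, h2, rfl⟩ := exists_isHomogeneous_of_mem_pow hJ (h1 m le_rfl)
  refine h2.eval_mem_pow_mul haJ (coeff_mem_of_coeff_mul_mem hc ?_)
  refine h.coeff_mem hJ hA (hσ.mul h2) ?_
  rwa [map_mul, add_comm]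

end Forms

/-! ### Regular sequences and extensions of modules. -/

section WeaklyRegular

open RingTheory.Sequence

/-- An element regular on the right-hand term keeps the left-hand map injective modulo that element,
so the short exact sequence survives each quotient. -/
lemma RingTheory.Sequence.IsWeaklyRegular.of_exact {S : Type*} [CommRing S]
    {M₁ M₂ M₃ : Type*} [AddCommGroup M₁] [AddCommGroup M₂] [AddCommGroup M₃]
    [Module S M₁] [Module S M₂] [Module S M₃] {f : M₁ →ₗ[S] M₂} {g : M₂ →ₗ[S] M₃}
    (hf : Function.Injective f) (hfg : Function.Exact f g) (hg : Function.Surjective g)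
    {rs : List S} (h₁ : IsWeaklyRegular M₁ rs) (h₃ : IsWeaklyRegular M₃ rs) :
    IsWeaklyRegular M₂ rs := by
  induction rs generalizing M₁ M₂ M₃ with
  | nil => exact IsWeaklyRegular.nil _ _
  | cons r rs ih =>
    rw [isWeaklyRegular_cons_iff] at h₁ h₃ ⊢
    refine ⟨isSMulRegular_of_range_eq_ker hf hfg.linearMap_ker_eq.symm h₁.1 h₃.1, ?_⟩
    have hz : Function.Exact (0 : PUnit →ₗ[S] M₁) f := by
      rw [LinearMap.exact_iff, LinearMap.ker_eq_bot.2 hf, LinearMap.range_zero]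
    have h := QuotSMulTop.map_first_exact_on_four_term_exact_of_isSMulRegular_last hz hfg h₃.1
    refine ih ?_ (QuotSMulTop.map_exact r hfg hg) (QuotSMulTop.map_surjective r hg) h₁.2 h₃.2
    rw [← LinearMap.ker_eq_bot, h.linearMap_ker_eq]
    simp

end WeaklyRegular

/-! ### Linear forms regular on modules with at most one relation. -/

section LinearForms

open MvPolynomial RingTheory.Sequence

variable {K : Type*} [Field K] {e : ℕ}

/-- The linear forms `X i - c i * X e`, for `i < e`. -/
noncomputable def lineForm (c : Fin e → K) (i : Fin e) : MvPolynomial (Fin (e + 1)) K :=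
  X i.castSucc - C (c i) * X (Fin.last e)

/-- The ideal generated by the first `j` of the forms `lineForm c i`. -/
noncomputable def lineIdeal (c : Fin e → K) (j : ℕ) : Ideal (MvPolynomial (Fin (e + 1)) K) :=
  Ideal.span (lineForm c '' {i | (i : ℕ) < j})

/-- The substitution `X i ↦ c i * X e` for `i < j`. -/
noncomputable def lineSubst (c : Fin e → K) (j : ℕ) :
    MvPolynomial (Fin (e + 1)) K →ₐ[K] MvPolynomial (Fin (e + 1)) K :=
  aeval (Fin.lastCases (X (Fin.last e))
    fun i => if (i : ℕ) < j then C (c i) * X (Fin.last e) else X i.castSucc)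

lemma lineSubst_last (c : Fin e → K) (j : ℕ) :
    lineSubst c j (X (Fin.last e)) = X (Fin.last e) := by
  simp [lineSubst]

lemma lineSubst_castSucc (c : Fin e → K) (j : ℕ) (i : Fin e) :
    lineSubst c j (X i.castSucc) =
      if (i : ℕ) < j then C (c i) * X (Fin.last e) else X i.castSucc := by
  simp [lineSubst]

lemma lineSubst_lineForm (c : Fin e → K) (j : ℕ) (i : Fin e) :
    lineSubst c j (lineForm c i) = if (i : ℕ) < j then 0 else lineForm c i := by
  have hC : ∀ r : K, lineSubst c j (C r) = C r := fun r => (lineSubst c j).commutes r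
  rw [lineForm, map_sub, map_mul, hC, lineSubst_last, lineSubst_castSucc]
  split_ifs <;> simp

lemma lineForm_ne_zero (c : Fin e → K) (i : Fin e) : lineForm c i ≠ 0 := by
  intro h
  have := congrArg (coeff (Finsupp.single i.castSucc 1)) h
  have h2 : ¬ (Finsupp.single (Fin.last e) 1 = Finsupp.single i.castSucc 1) := by
    intro h3
    exact (Fin.castSucc_lt_last i).ne' (Finsupp.single_left_injective one_ne_zero h3)
  simp [lineForm, coeff_C_mul, coeff_X, h2] at this

/-- The ideal is the kernel of a substitution into a domain; this makes it prime, which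
`mem_lineIdeal_of_mul_mem` uses. -/
lemma mem_lineIdeal_iff (c : Fin e → K) (j : ℕ) (s : MvPolynomial (Fin (e + 1)) K) :
    s ∈ lineIdeal c j ↔ lineSubst c j s = 0 := by
  constructor
  · intro h
    have : lineIdeal c j ≤ RingHom.ker (lineSubst c j) := by
      rw [lineIdeal, Ideal.span_le]
      rintro _ ⟨i, hi, rfl⟩
      rw [SetLike.mem_coe, RingHom.mem_ker, lineSubst_lineForm, if_pos (show (i : ℕ) < j from hi)]
    exact this h
  · intro h
    have key : (Ideal.Quotient.mkₐ K (lineIdeal c j)).comp (lineSubst c j) =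
        Ideal.Quotient.mkₐ K (lineIdeal c j) := by
      refine algHom_ext fun i => ?_
      induction i using Fin.lastCases with
      | last => rw [AlgHom.comp_apply, lineSubst_last]
      | cast i =>
        rw [AlgHom.comp_apply, lineSubst_castSucc]
        split_ifs with hi
        · symm
          rw [Ideal.Quotient.mkₐ_eq_mk, Ideal.Quotient.mk_eq_mk_iff_sub_mem]
          exact Ideal.subset_span ⟨i, hi, rfl⟩
        · rfl
    have h2 := congrArg (fun φ => φ s) key
    simp only [AlgHom.comp_apply, h, map_zero] at h2
    rw [Ideal.Quotient.mkₐ_eq_mk] at h2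
    exact Ideal.Quotient.eq_zero_iff_mem.1 h2.symm

lemma mem_lineIdeal_of_mul_mem {c : Fin e → K} {j : ℕ} {s g : MvPolynomial (Fin (e + 1)) K}
    (h : s * g ∈ lineIdeal c j) (hg : g ∉ lineIdeal c j) : s ∈ lineIdeal c j := by
  rw [mem_lineIdeal_iff] at *
  rw [map_mul] at h
  exact (mul_eq_zero.1 h).resolve_right hg

lemma lineForm_notMem (c : Fin e → K) (j : Fin e) : lineForm c j ∉ lineIdeal c j := by
  rw [mem_lineIdeal_iff, lineSubst_lineForm, if_neg (lt_irrefl _)]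
  exact lineForm_ne_zero c j

lemma lineIdeal_succ (c : Fin e → K) (j : Fin e) :
    lineIdeal c (j + 1) = Ideal.span {lineForm c j} ⊔ lineIdeal c j := by
  rw [lineIdeal, lineIdeal, ← Ideal.span_union, ← Set.image_singleton, ← Set.image_union]
  congr 2
  ext i
  have : i = j ↔ (i : ℕ) = j := Fin.ext_iff
  simp only [Set.mem_ofPred_eq, Set.mem_union, Set.mem_singleton_iff, this]
  omega

lemma notMem_lineIdeal {c : Fin e → K} {p : Fin (e + 1) → K} (hp : p (Fin.last e) ≠ 0)
    (hc : ∀ i, c i = p i.castSucc / p (Fin.last e)) {g : MvPolynomial (Fin (e + 1)) K}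
    (hg : eval p g ≠ 0) (j : ℕ) : g ∉ lineIdeal c j := by
  intro h
  have : lineIdeal c j ≤ RingHom.ker (eval p) := by
    rw [lineIdeal, Ideal.span_le]
    rintro _ ⟨i, hi, rfl⟩
    rw [SetLike.mem_coe, RingHom.mem_ker, lineForm]
    simp [hc, hp]
  exact hg (this h)

lemma pi_mem_smul_top {S ι : Type*} [CommRing S] [Fintype ι] {I : Ideal S} {v : ι → S}
    (h : ∀ i, v i ∈ I) : v ∈ (I • ⊤ : Submodule S (ι → S)) := by
  classical
  rw [← Finset.univ_sum_single v]
  refine Submodule.sum_mem _ fun i _ => ?_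
  have : Pi.single i (v i) = v i • (Pi.single i 1 : ι → S) := by
    ext k; by_cases hk : k = i
    · subst hk; simp
    · simp [hk]
  rw [this]
  exact Submodule.smul_mem_smul (h i) trivial

lemma pi_apply_mem_of_mem_smul_top {S ι : Type*} [CommRing S] {I : Ideal S} {v : ι → S}
    (h : v ∈ (I • ⊤ : Submodule S (ι → S))) (i : ι) : v i ∈ I := by
  induction h using Submodule.smul_induction_on' with
  | smul r hr w _ => exact I.mul_mem_right _ hr
  | add _ _ _ _ h1 h2 => exact I.add_mem h1 h2

/-- M is free modulo the multiples of g. All the line ideals are prime and vanish at p, so some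
component of a nonzero g stays outside them; this is what keeps g from creating zero divisors. -/
lemma isWeaklyRegular_lineForm {M ι : Type*} [AddCommGroup M]
    [Module (MvPolynomial (Fin (e + 1)) K) M] [Fintype ι]
    {π : (ι → MvPolynomial (Fin (e + 1)) K) →ₗ[MvPolynomial (Fin (e + 1)) K] M}
    (hπ : Function.Surjective π) {g : ι → MvPolynomial (Fin (e + 1)) K}
    (hker : ∀ v, π v = 0 ↔ ∃ t : MvPolynomial (Fin (e + 1)) K, v = t • g)
    {c : Fin e → K} {p : Fin (e + 1) → K} (hp : p (Fin.last e) ≠ 0)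
    (hc : ∀ i, c i = p i.castSucc / p (Fin.last e)) (hg : g = 0 ∨ ∃ i, eval p (g i) ≠ 0) :
    IsWeaklyRegular M (List.ofFn (lineForm c)) := by
  refine ⟨fun j hj => ?_⟩
  rw [List.length_ofFn] at hj
  rw [isSMulRegular_quotient_iff_mem_of_smul_mem, List.getElem_ofFn, Ideal.ofList_take_ofFn]
  change ∀ x, lineForm c ⟨j, hj⟩ • x ∈ (lineIdeal c j • ⊤ : Submodule _ M) →
    x ∈ (lineIdeal c j • ⊤ : Submodule _ M)
  set l := lineForm c ⟨j, hj⟩ with hl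
  have hl' : l ∉ lineIdeal c j := lineForm_notMem c ⟨j, hj⟩
  have hmap : (lineIdeal c j • ⊤ : Submodule _ M) = (lineIdeal c j • ⊤ : Submodule _ _).map π := by
    rw [Submodule.map_smul'', Submodule.map_top, LinearMap.range_eq_top.2 hπ]
  intro x hx
  obtain ⟨v, rfl⟩ := hπ x
  rw [hmap, ← map_smul, Submodule.mem_map] at hx
  obtain ⟨w, hw, hwv⟩ := hx
  rw [← sub_eq_zero, ← map_sub, hker] at hwv
  obtain ⟨t, ht⟩ := hwv
  have hw' := pi_apply_mem_of_mem_smul_top hw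
  have ht' : ∀ i, w i - l * v i = t * g i := fun i => congrFun ht i
  rw [hmap]
  obtain rfl | ⟨i₀, hi₀⟩ := hg
  · refine Submodule.mem_map_of_mem (pi_mem_smul_top fun i => ?_)
    have h1 := ht' i
    refine mem_lineIdeal_of_mul_mem (g := l) ?_ hl'
    rw [Pi.zero_apply, mul_zero, sub_eq_zero] at h1
    rw [mul_comm, ← h1]
    exact hw' i
  -- Here l v = w - t g with w in the j-th ideal, so t g i₀ lies in the next ideal and hence so does
  -- t. With t = s l + t₀, the vector v + s g represents the same class as v, and l (v + s g) = w -
  -- t₀ g is in the j-th ideal.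
  · have h1 : t ∈ lineIdeal c (j + 1) := by
      refine mem_lineIdeal_of_mul_mem (g := g i₀) ?_ (notMem_lineIdeal hp hc hi₀ _)
      rw [← ht' i₀, lineIdeal_succ c ⟨j, hj⟩]
      exact Ideal.sub_mem _ (Ideal.mem_sup_right (hw' i₀))
        (Ideal.mem_sup_left (Ideal.mul_mem_right _ _ (Ideal.mem_span_singleton_self _)))
    rw [lineIdeal_succ c ⟨j, hj⟩, Submodule.mem_sup] at h1
    obtain ⟨_, hs, t₀, ht₀, rfl⟩ := h1
    obtain ⟨s, rfl⟩ := Ideal.mem_span_singleton'.1 hs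
    have h2 : π v = π (v + s • g) := by
      have : π (s • g) = 0 := (hker _).2 ⟨s, rfl⟩
      rw [map_add, this, add_zero]
    rw [h2]
    refine Submodule.mem_map_of_mem (pi_mem_smul_top fun i => ?_)
    refine mem_lineIdeal_of_mul_mem (g := l) ?_ hl'
    have h3 : (v + s • g) i * l = w i - t₀ * g i := by
      have h4 := ht' i
      simp only [Pi.add_apply, Pi.smul_apply, smul_eq_mul]
      rw [add_mul, ← hl] at h4
      linear_combination -h4
    rw [h3]
    exact Ideal.sub_mem _ (hw' i) (Ideal.mul_mem_right _ _ ht₀)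

/-- A torsion-free module over a factorial domain with two generators is free, or is presented by
a single relation. -/
lemma exists_presentation_of_two_generators {S M : Type*} [CommRing S] [IsDomain S]
    [UniqueFactorizationMonoid S] [AddCommGroup M] [Module S M] (z₁ z₂ : M)
    (hgen : ∀ x : M, ∃ s t : S, x = s • z₁ + t • z₂)
    (htf : ∀ (s : S) (x : M), s ≠ 0 → s • x = 0 → x = 0) :
    ∃ (n : ℕ) (π : (Fin n → S) →ₗ[S] M) (g : Fin n → S), Function.Surjective π ∧
      ∀ v, π v = 0 ↔ ∃ t : S, v = t • g := by
  by_cases h0 : z₁ = 0 ∧ z₂ = 0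
  · refine ⟨0, 0, 0, fun x => ⟨0, ?_⟩, fun v => ?_⟩
    · obtain ⟨s, t, rfl⟩ := hgen x
      simp [h0.1, h0.2]
    · simp [Subsingleton.elim v 0]
  wlog h1 : z₁ ≠ 0 generalizing z₁ z₂
  · refine this z₂ z₁ (fun x => ?_) (by tauto) (by tauto)
    obtain ⟨s, t, rfl⟩ := hgen x
    exact ⟨t, s, add_comm _ _⟩
  let π : (Fin 2 → S) →ₗ[S] M := Fintype.linearCombination S ![z₁, z₂]
  have hπ : ∀ v, π v = v 0 • z₁ + v 1 • z₂ := fun v => by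
    simp [π, Fintype.linearCombination_apply, Fin.sum_univ_two]
  have hsurj : Function.Surjective π := fun x => by
    obtain ⟨s, t, rfl⟩ := hgen x
    exact ⟨![s, t], by simp [hπ]⟩
  by_cases hker : ∀ v, π v = 0 → v = 0
  · refine ⟨2, π, 0, hsurj, fun v => ⟨fun h => ⟨0, by simp [hker v h]⟩, ?_⟩⟩
    rintro ⟨t, rfl⟩
    simp
  push Not at hker
  obtain ⟨v, hv, hv0⟩ := hker
  -- Dividing a nonzero relation by its gcd leaves a relation, as M is torsion-free; the coprime
  -- pair (s, t) generates all relations.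
  obtain ⟨s, t, r, hrel, hs, ht⟩ : ∃ s t r : S, IsRelPrime s t ∧ r * s = v 0 ∧ r * t = v 1 := by
    by_cases hv00 : v 0 = 0
    · exact ⟨0, 1, v 1, isRelPrime_one_right, by simp [hv00], by simp⟩
    · obtain ⟨s, t, r, h, h1, h2⟩ :=
        UniqueFactorizationMonoid.exists_reduced_factors (v 0) hv00 (v 1)
      exact ⟨s, t, r, h, h1, h2⟩
  have hr0 : r ≠ 0 := by
    rintro rfl
    refine hv0 (funext fun i => ?_)
    fin_cases i
    · simpa using hs.symm
    · simpa using ht.symm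
  have hst : s • z₁ + t • z₂ = 0 := by
    refine htf r _ hr0 ?_
    rw [smul_add, smul_smul, smul_smul, hs, ht, ← hπ, hv]
  refine ⟨2, π, ![s, t], hsurj, fun w => ⟨fun hw => ?_, ?_⟩⟩
  · rw [hπ] at hw
    -- Two relations are proportional, since otherwise eliminating z₂ would give a nonzero scalar
    -- killing z₁.
    have h2 : t * w 0 = w 1 * s := by
      by_contra hne
      refine h1 (htf (t * w 0 - w 1 * s) z₁ (sub_ne_zero.2 hne) ?_)
      have h3 : (t * w 0 - w 1 * s) • z₁ =
          t • (w 0 • z₁ + w 1 • z₂) - w 1 • (s • z₁ + t • z₂) := by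
        simp only [smul_add, smul_smul, sub_smul]
        rw [mul_comm (w 1) t]
        abel
      rw [h3, hw, hst, smul_zero, smul_zero, sub_zero]
    by_cases hs0 : s = 0
    · subst hs0
      rw [isRelPrime_zero_left] at hrel
      obtain ⟨u, rfl⟩ := hrel
      have h4 : w 0 = 0 := by
        have : (u : S) * w 0 = 0 := by simpa using h2
        simpa using this
      refine ⟨w 1 * (u⁻¹ : Sˣ), funext fun i => ?_⟩
      fin_cases i <;> simp [h4]
    · have h3 : s ∣ w 0 := hrel.dvd_of_dvd_mul_left ⟨w 1, by rw [h2, mul_comm]⟩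
      obtain ⟨q, hq⟩ := h3
      refine ⟨q, funext fun i => ?_⟩
      fin_cases i
      · simp [hq, mul_comm]
      · simp only [Fin.mk_one, Pi.smul_apply, Matrix.cons_val_one, Matrix.cons_val_fin_one,
          smul_eq_mul]
        refine mul_right_cancel₀ hs0 ?_
        rw [← h2, hq]; ring
  · rintro ⟨q, rfl⟩
    rw [map_smul, hπ]
    simp [hst]

/-- D turns the condition on p into the nonvanishing of one polynomial, so that several conditions
can be met at a common point. -/
lemma exists_ne_zero_imp_eval_ne_zero {κ : Type*} (f : κ → MvPolynomial (Fin (e + 1)) K) :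
    ∃ D : MvPolynomial (Fin (e + 1)) K, D ≠ 0 ∧
      ∀ p, eval p D ≠ 0 → f = 0 ∨ ∃ i, eval p (f i) ≠ 0 := by
  by_cases hf : f = 0
  · exact ⟨1, one_ne_zero, fun _ _ => Or.inl hf⟩
  · obtain ⟨i, hi⟩ := Function.ne_iff.1 hf
    exact ⟨f i, hi, fun p hp => Or.inr ⟨i, hp⟩⟩

/-- Depth criterion: if `F` has a finitely generated submodule presented by a single relation, and
the quotient is torsion-free with two generators, then suitable linear forms are `F`-regular. -/
theorem exists_isWeaklyRegular_lineForm [Infinite K] {F ι : Type*} [AddCommGroup F]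
    [Module (MvPolynomial (Fin (e + 1)) K) F] [Fintype ι] (y : ι → F) (z₁ z₂ : F)
    (hker : ∃ g : ι → MvPolynomial (Fin (e + 1)) K, ∀ s : ι → MvPolynomial (Fin (e + 1)) K,
      ∑ i, s i • y i = 0 ↔ ∃ t : MvPolynomial (Fin (e + 1)) K, s = t • g)
    (hgen : ∀ x : F, ∃ s t : MvPolynomial (Fin (e + 1)) K, x - (s • z₁ + t • z₂) ∈
      Submodule.span (MvPolynomial (Fin (e + 1)) K) (Set.range y))
    (htf : ∀ (s : MvPolynomial (Fin (e + 1)) K) (x : F), s ≠ 0 →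
      s • x ∈ Submodule.span (MvPolynomial (Fin (e + 1)) K) (Set.range y) →
      x ∈ Submodule.span (MvPolynomial (Fin (e + 1)) K) (Set.range y)) :
    ∃ c : Fin e → K, IsWeaklyRegular F (List.ofFn (lineForm c)) := by
  set N := Submodule.span (MvPolynomial (Fin (e + 1)) K) (Set.range y) with hN
  obtain ⟨g, hg⟩ := hker
  obtain ⟨n, π, h, hπ, hh⟩ := exists_presentation_of_two_generators
    (S := MvPolynomial (Fin (e + 1)) K) (M := F ⧸ N) (N.mkQ z₁) (N.mkQ z₂)
    (fun x => by
      obtain ⟨x, rfl⟩ := N.mkQ_surjective x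
      obtain ⟨s, t, hst⟩ := hgen x
      refine ⟨s, t, ?_⟩
      rw [← map_smul, ← map_smul, ← map_add, ← sub_eq_zero, ← map_sub]
      rwa [Submodule.mkQ_apply, Submodule.Quotient.mk_eq_zero])
    (fun s x hs hx => by
      obtain ⟨x, rfl⟩ := N.mkQ_surjective x
      rw [← map_smul, Submodule.mkQ_apply, Submodule.Quotient.mk_eq_zero] at hx
      rw [Submodule.mkQ_apply, Submodule.Quotient.mk_eq_zero]
      exact htf s x hs hx)
  obtain ⟨D₁, hD₁, hD₁'⟩ := exists_ne_zero_imp_eval_ne_zero g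
  obtain ⟨D₂, hD₂, hD₂'⟩ := exists_ne_zero_imp_eval_ne_zero h
  obtain ⟨p, hp⟩ : ∃ p, eval p (D₁ * D₂ * X (Fin.last e)) ≠ 0 := by
    by_contra! hcon
    exact mul_ne_zero (mul_ne_zero hD₁ hD₂) (X_ne_zero (Fin.last e))
      (MvPolynomial.funext (q := 0) fun p => by rw [hcon, map_zero])
  rw [map_mul, map_mul, eval_X] at hp
  have hp1 := right_ne_zero_of_mul hp
  have hp2 := right_ne_zero_of_mul (left_ne_zero_of_mul hp)
  have hp3 := left_ne_zero_of_mul (left_ne_zero_of_mul hp)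
  refine ⟨fun i => p i.castSucc / p (Fin.last e), ?_⟩
  have hq := isWeaklyRegular_lineForm hπ hh hp1 (fun _ => rfl) (hD₂' p hp2)
  let π₁ : (ι → MvPolynomial (Fin (e + 1)) K) →ₗ[MvPolynomial (Fin (e + 1)) K] N :=
    (Fintype.linearCombination (MvPolynomial (Fin (e + 1)) K) y).codRestrict N fun v => by
      rw [Fintype.linearCombination_apply]
      exact Submodule.sum_mem _ fun i _ => N.smul_mem _ (Submodule.subset_span ⟨i, rfl⟩)
  have hπ₁ : Function.Surjective π₁ := by
    rintro ⟨x, hx⟩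
    rw [hN, Submodule.mem_span_range_iff_exists_fun] at hx
    obtain ⟨v, hv⟩ := hx
    exact ⟨v, Subtype.ext (by simp [π₁, Fintype.linearCombination_apply, hv])⟩
  have hs := isWeaklyRegular_lineForm (M := N) hπ₁ (g := g) (fun v => by
    rw [← hg, Subtype.ext_iff]
    simp [π₁, Fintype.linearCombination_apply]) hp1 (fun _ => rfl) (hD₁' p hp3)
  exact IsWeaklyRegular.of_exact N.injective_subtype
    (LinearMap.exact_subtype_mkQ N) N.mkQ_surjective hs hq

end LinearForms

/-! ### Reductions, minimal reductions and their generators. -/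

section Reductions

open MvPolynomial

variable {R : Type*} [CommRing R]

lemma pow_add_eq_of_isReduction {I J : Ideal R} {n : ℕ} (h : I ^ (n + 1) = J * I ^ n) (t : ℕ) :
    I ^ (n + t) = J ^ t * I ^ n := by
  induction t with
  | zero => simp
  | succ t ih => rw [← add_assoc, pow_succ', ih, mul_left_comm, ← pow_succ', h, pow_succ,
      mul_assoc]

lemma IsReduction.trans {K J I : Ideal R} (h₁ : IsReduction K J) (h₂ : IsReduction J I) :
    IsReduction K I := by
  obtain ⟨hKJ, n, hn⟩ := h₁
  obtain ⟨hJI, m, hm⟩ := h₂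
  refine ⟨hKJ.trans hJI, m + n, ?_⟩
  rw [add_assoc, pow_add_eq_of_isReduction hm, hn, pow_add_eq_of_isReduction hm, mul_assoc]

lemma IsMinimalReduction.eq_of_isReduction {J I K : Ideal R} (hJ : IsMinimalReduction J I)
    (hK : IsReduction K J) : K = J :=
  le_antisymm hK.1 (hJ.2 (hK.trans hJ.1) hK.1)

lemma IsReduction.radical_eq {J I : Ideal R} (hJ : IsReduction J I) : J.radical = I.radical := by
  obtain ⟨hJI, n, hn⟩ := hJ
  refine le_antisymm (Ideal.radical_mono hJI) (Ideal.radical_le_radical_iff.2 fun x hx => ?_)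
  exact ⟨n + 1, Ideal.mul_le_left (hn ▸ Ideal.pow_mem_pow hx (n + 1))⟩

variable [IsLocalRing R] [IsNoetherianRing R]

omit [IsNoetherianRing R] in
lemma Ideal.le_of_le_sup_maximalIdeal_mul {A B : Ideal R} (hA : A.FG)
    (h : A ≤ B ⊔ maximalIdeal R * A) : A ≤ B :=
  Submodule.le_of_le_smul_of_le_jacobson_bot (I := maximalIdeal R) hA
    (by rw [IsLocalRing.jacobson_eq_maximalIdeal _ bot_ne_top]) h

omit [IsLocalRing R] [IsNoetherianRing R] in
-- Telescoping on monomials: each replacement of a factor aᵢ by bᵢ costs an element of K times n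
-- factors from J.
lemma MvPolynomial.IsHomogeneous.eval_sub_eval_mem {ι : Type*} {a b : ι → R} {K J : Ideal R}
    (ha : ∀ i, a i ∈ J) (hb : ∀ i, b i ∈ J) (hab : ∀ i, a i - b i ∈ K) {n : ℕ}
    {σ : MvPolynomial ι R} (hσ : σ.IsHomogeneous (n + 1)) :
    eval a σ - eval b σ ∈ K * J ^ n := by
  classical
  have key : ∀ m : ι →₀ ℕ, (m.prod fun i k => a i ^ k) - (m.prod fun i k => b i ^ k) ∈
      K * J ^ (m.degree - 1) := by
    intro m
    induction m using Finsupp.induction_linear with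
    | zero => simp
    | add f g hf hg =>
      rw [Finsupp.prod_add_index' (by simp) (by simp [pow_add]),
        Finsupp.prod_add_index' (by simp) (by simp [pow_add])]
      have e : (f.prod fun i k => a i ^ k) * (g.prod fun i k => a i ^ k) -
          (f.prod fun i k => b i ^ k) * (g.prod fun i k => b i ^ k) =
          ((f.prod fun i k => a i ^ k) - (f.prod fun i k => b i ^ k)) *
            (g.prod fun i k => a i ^ k) +
          ((g.prod fun i k => a i ^ k) - (g.prod fun i k => b i ^ k)) *
            (f.prod fun i k => b i ^ k) := by ring
      have h1 : (g.prod fun i k => a i ^ k) ∈ J ^ g.degree :=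
        Ideal.finsupp_prod_pow_mem_pow g fun i _ => ha i
      have h2 : (f.prod fun i k => b i ^ k) ∈ J ^ f.degree :=
        Ideal.finsupp_prod_pow_mem_pow f fun i _ => hb i
      rw [e, map_add]
      refine add_mem ?_ ?_
      · by_cases hf0 : f = 0
        · subst hf0; simp
        · have := Ideal.mul_mem_mul hf h1
          rw [mul_assoc, ← pow_add] at this
          have h0 : f.degree ≠ 0 := by rwa [Ne, Finsupp.degree_eq_zero_iff]
          rwa [show f.degree - 1 + g.degree = f.degree + g.degree - 1 by omega] at this
      · by_cases hg0 : g = 0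
        · subst hg0; simp
        · have := Ideal.mul_mem_mul hg h2
          rw [mul_assoc, ← pow_add] at this
          have h0 : g.degree ≠ 0 := by rwa [Ne, Finsupp.degree_eq_zero_iff]
          rwa [show g.degree - 1 + f.degree = f.degree + g.degree - 1 by omega] at this
    | single i k =>
      rw [Finsupp.prod_single_index (by simp), Finsupp.prod_single_index (by simp),
        Finsupp.degree_single]
      cases k with
      | zero => simp
      | succ k =>
        rw [← (Commute.all (a i) (b i)).geom_sum₂_mul, mul_comm _ (a i - b i), Nat.add_sub_cancel]
        refine Ideal.mul_mem_mul (hab i) (Ideal.sum_mem _ fun t ht => ?_)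
        rw [Finset.mem_range] at ht
        have := Ideal.mul_mem_mul (Ideal.pow_mem_pow (ha i) t)
          (Ideal.pow_mem_pow (hb i) (k + 1 - 1 - t))
        rwa [← pow_add, show t + (k + 1 - 1 - t) = k by omega] at this
  rw [eval_eq, eval_eq, ← Finset.sum_sub_distrib]
  refine Ideal.sum_mem _ fun m hm => ?_
  rw [← mul_sub]
  have := key m
  rw [hσ.degree_eq (mem_support_iff.1 hm)] at this
  exact Ideal.mul_mem_left _ _ this

omit [IsLocalRing R] [IsNoetherianRing R] in
lemma MvPolynomial.IsHomogeneous.eval_mul_right {ι : Type*} {q : ι → R} (x : R) {n : ℕ}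
    {σ : MvPolynomial ι R} (hσ : σ.IsHomogeneous n) :
    eval (fun i => q i * x) σ = eval q σ * x ^ n := by
  rw [eval_eq, eval_eq, Finset.sum_mul]
  refine Finset.sum_congr rfl fun m hm => ?_
  simp only [mul_pow]
  rw [Finset.prod_mul_distrib, Finset.prod_pow_eq_pow_sum, ← Finsupp.degree_apply,
    hσ.degree_eq (mem_support_iff.1 hm), mul_assoc]

omit [IsLocalRing R] [IsNoetherianRing R] in
lemma sup_span_singleton_pow_le (K : Ideal R) (x : R) (n : ℕ) :
    (K ⊔ Ideal.span {x}) ^ (n + 1) ≤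
      K * (K ⊔ Ideal.span {x}) ^ n ⊔ Ideal.span {x ^ (n + 1)} := by
  induction n with
  | zero => simp
  | succ n ih =>
    conv_lhs => rw [pow_succ', Ideal.sup_mul]
    refine sup_le le_sup_left ((Ideal.mul_mono_right ih).trans ?_)
    rw [Ideal.mul_sup, Ideal.span_singleton_mul_span_singleton, ← pow_succ']
    refine sup_le_sup_right ?_ _
    rw [mul_left_comm]
    refine Ideal.mul_mono_right ?_
    rw [pow_succ' _ n]
    exact Ideal.mul_mono_left le_sup_right

omit [IsLocalRing R] [IsNoetherianRing R] in
lemma span_range_ne_of_eq_zero {ι : Type*} [Fintype ι] {J : Ideal R}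
    (hι : Fintype.card ι = J.spanFinrank) (b : ι → R) (j : ι) (hb : b j = 0) :
    Ideal.span (Set.range b) ≠ J := by
  classical
  intro h
  have h1 : Ideal.span (b '' (Set.univ \ {j})) = J := by
    rw [← h]
    refine le_antisymm (Ideal.span_mono (Set.image_subset_range _ _)) (Ideal.span_le.2 ?_)
    rintro _ ⟨i, rfl⟩
    by_cases hi : i = j
    · subst hi; rw [hb]; exact zero_mem _
    · exact Ideal.subset_span ⟨i, by simpa using hi, rfl⟩
  have h2 := Submodule.spanFinrank_span_le_ncard_of_finite (R := R)
    (s := b '' (Set.univ \ {j})) (Set.toFinite _)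
  rw [← Ideal.span, h1] at h2
  have h3 := Set.ncard_image_le (f := b) (s := Set.univ \ {j}) (Set.toFinite _)
  have h4 : (Set.univ \ {j} : Set ι).ncard < (Set.univ : Set ι).ncard :=
    Set.ncard_lt_ncard (by
      refine ⟨Set.sdiff_subset, fun h => ?_⟩
      simpa using h (Set.mem_univ j))
  rw [Set.ncard_univ, Nat.card_eq_fintype_card] at h4
  omega

/-- If an ideal has no proper reduction, then a form with a unit coefficient in a minimal system of
generators is part of a minimal system of generators of the corresponding power. -/
lemma eval_notMem_of_forall_isReduction [Infinite (ResidueField R)] {J : Ideal R}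
    (hJ : ∀ K, IsReduction K J → K = J) {μ : ℕ} (hμ : μ = J.spanFinrank) {a : Fin μ → R}
    (ha : Ideal.span (Set.range a) = J) {n : ℕ} {σ : MvPolynomial (Fin μ) R}
    (hσ : σ.IsHomogeneous n) (hc : ∃ m, coeff m σ ∉ maximalIdeal R) :
    eval a σ ∉ maximalIdeal R * J ^ n := by
  intro hmem
  have haJ : ∀ i, a i ∈ J := fun i => by rw [← ha]; exact Ideal.subset_span ⟨i, rfl⟩
  obtain ⟨m, hm⟩ := hc
  cases n with
  | zero =>
    have hm0 : coeff m σ ≠ 0 := fun h => hm (by rw [h]; exact zero_mem _)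
    have h0 : m = 0 := (Finsupp.degree_eq_zero_iff m).1 (hσ.degree_eq hm0)
    subst h0
    rw [← totalDegree_zero_iff_isHomogeneous, totalDegree_eq_zero_iff_eq_C] at hσ
    rw [hσ, eval_C, pow_zero, Ideal.one_eq_top, Ideal.mul_top] at hmem
    exact hm hmem
  | succ n =>
    have hσ' : map (residue R) σ ≠ 0 := fun h => hm (by
      have := congrArg (coeff m) h
      rwa [coeff_map, coeff_zero, residue_eq_zero_iff] at this)
    obtain ⟨p, hp⟩ : ∃ p, eval p (map (residue R) σ) ≠ 0 := by
      by_contra! hcon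
      exact hσ' (MvPolynomial.funext (q := 0) fun p => by rw [hcon, map_zero])
    choose q hq using fun i => residue_surjective (p i)
    obtain rfl : p = fun i => residue R (q i) := funext fun i => (hq i).symm
    have hqu : IsUnit (eval q σ) := by
      rw [eval_map] at hp
      have h1 : eval₂ (residue R) (fun i => residue R (q i)) σ = residue R (eval q σ) := by
        rw [eval, coe_eval₂Hom, ← RingHom.comp_id (residue R)]
        exact (eval₂_comp_left (residue R) (RingHom.id R) q σ).symm
      rw [h1] at hp
      rwa [← residue_ne_zero_iff_isUnit]
    obtain ⟨j, hj⟩ : ∃ j, IsUnit (q j) := by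
      by_contra! hcon
      have h1 : eval q σ ∈ maximalIdeal R ^ (n + 1) := hσ.eval_mem_pow fun i =>
        (mem_maximalIdeal _).2 (hcon i)
      exact (mem_maximalIdeal _).1 (Ideal.pow_le_self (by omega) h1) hqu
    obtain ⟨v, hv⟩ := hj
    -- Linear change of generators along the point q, as in Noether normalization: bⱼ = 0, and
    -- modulo K = (b) each aᵢ is qᵢ times v⁻¹aⱼ. So σ(a) becomes the unit σ(q) times a power of
    -- v⁻¹aⱼ, and a relation in the fiber cone of J would make K a reduction with too few
    -- generators.
    let b : Fin μ → R := fun i => a i - q i * ((v⁻¹ : Rˣ) * a j)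
    have hbj : b j = 0 := by simp [b, ← hv]
    set K := Ideal.span (Set.range b) with hK
    have hbK : ∀ i, b i ∈ K := fun i => Ideal.subset_span ⟨i, rfl⟩
    have hKJ : K ≤ J := by
      rw [hK, Ideal.span_le]
      rintro _ ⟨i, rfl⟩
      exact J.sub_mem (haJ i) (J.mul_mem_left _ (J.mul_mem_left _ (haJ j)))
    have hJK : K ⊔ Ideal.span {a j} = J := by
      refine le_antisymm (sup_le hKJ ((Ideal.span_singleton_le_iff_mem _).2 (haJ j))) ?_
      conv_lhs => rw [← ha]
      rw [Ideal.span_le]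
      rintro _ ⟨i, rfl⟩
      have : a i = b i + q i * ((v⁻¹ : Rˣ) * a j) := by simp [b]
      rw [SetLike.mem_coe, this]
      exact add_mem (Ideal.mem_sup_left (hbK i)) (Ideal.mem_sup_right
        (Ideal.mul_mem_left _ _ (Ideal.mul_mem_left _ _ (Ideal.mem_span_singleton_self _))))
    have hpow : a j ^ (n + 1) ∈ K * J ^ n ⊔ maximalIdeal R * J ^ (n + 1) := by
      have h1 := hσ.eval_sub_eval_mem haJ (b := fun i => q i * ((v⁻¹ : Rˣ) * a j))
        (fun i => J.mul_mem_left _ (J.mul_mem_left _ (haJ j))) hbK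
      rw [hσ.eval_mul_right] at h1
      have h2 := sub_mem (Ideal.mem_sup_right hmem) (Ideal.mem_sup_left h1) (S := Ideal R)
        (H := K * J ^ n ⊔ maximalIdeal R * J ^ (n + 1))
      rw [sub_sub_cancel, Ideal.unit_mul_mem_iff_mem _ hqu, mul_pow,
        Ideal.unit_mul_mem_iff_mem _ (v⁻¹.isUnit.pow _)] at h2
      exact h2
    have hle : J ^ (n + 1) ≤ K * J ^ n := by
      refine Ideal.le_of_le_sup_maximalIdeal_mul (IsNoetherian.noetherian _) ?_
      have h1 := sup_span_singleton_pow_le K (a j) n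
      rw [hJK] at h1
      refine h1.trans (sup_le le_sup_left ((Ideal.span_singleton_le_iff_mem _).2 hpow))
    have hKred : IsReduction K J :=
      ⟨hKJ, n, le_antisymm hle (by rw [pow_succ']; exact Ideal.mul_mono_left hKJ)⟩
    exact span_range_ne_of_eq_zero (by simpa using hμ) b j hbj (hJ K hKred)

/-- A minimal reduction `J` of `I` satisfies `J ⊓ 𝔪 I = 𝔪 J`. -/
lemma IsMinimalReduction.inf_le {I J : Ideal R} (hJ : IsMinimalReduction J I) {μ : ℕ}
    (hμ : μ = J.spanFinrank) {a : Fin μ → R} (ha : Ideal.span (Set.range a) = J) :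
    J ⊓ maximalIdeal R * I ≤ maximalIdeal R * J := by
  classical
  rintro x ⟨hxJ, hxI⟩
  obtain ⟨hJI, n, hn⟩ := hJ.1
  have haJ : ∀ i, a i ∈ J := fun i => by rw [← ha]; exact Ideal.subset_span ⟨i, rfl⟩
  rw [SetLike.mem_coe, ← ha, Ideal.mem_span_range_iff_exists_fun] at hxJ
  obtain ⟨r, rfl⟩ := hxJ
  by_cases hr : ∀ i, r i ∈ maximalIdeal R
  · exact Ideal.sum_mem _ fun i _ => Ideal.mul_mem_mul (hr i) (haJ i)
  push Not at hr
  obtain ⟨j, hj⟩ := hr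
  have hj : IsUnit (r j) := by
    by_contra h; exact hj ((mem_maximalIdeal _).2 h)
  exfalso
  -- A unit coefficient rⱼ puts aⱼ in K + 𝔪I, where K omits aⱼ. By Nakayama K is still a reduction
  -- of I, against the minimality of J.
  let b : Fin μ → R := Function.update a j 0
  set K := Ideal.span (Set.range b) with hK
  have hbj : b j = 0 := by simp [b]
  have hKJ : K ≤ J := by
    rw [hK, Ideal.span_le]
    rintro _ ⟨i, rfl⟩
    by_cases hi : i = j
    · subst hi; rw [SetLike.mem_coe, hbj]; exact zero_mem _
    · simpa [b, hi] using haJ i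
  have hab : ∀ i, i ≠ j → a i ∈ K := fun i hi =>
    Ideal.subset_span ⟨i, by simp [b, hi]⟩
  have hJK : J ≤ K ⊔ maximalIdeal R * I := by
    rw [← ha, Ideal.span_le]
    rintro _ ⟨i, rfl⟩
    by_cases hi : i = j
    · subst hi
      rw [SetLike.mem_coe, ← Ideal.unit_mul_mem_iff_mem _ hj]
      rw [← Finset.add_sum_erase _ _ (Finset.mem_univ i)] at hxI
      refine (Ideal.add_mem_iff_left _ (Ideal.mem_sup_left (Ideal.sum_mem _ fun k hk => ?_))).1
        (Ideal.mem_sup_right hxI)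
      exact K.mul_mem_left _ (hab k (Finset.ne_of_mem_erase hk))
    · exact Ideal.mem_sup_left (hab i hi)
  have hle : I ^ (n + 1) ≤ K * I ^ n := by
    refine Ideal.le_of_le_sup_maximalIdeal_mul (IsNoetherian.noetherian _) ?_
    conv_lhs => rw [hn]
    refine (Ideal.mul_mono_left hJK).trans ?_
    rw [Ideal.sup_mul, mul_assoc, ← pow_succ']
  have hKI : IsReduction K I := ⟨hKJ.trans hJI, n,
    le_antisymm hle (by rw [pow_succ']; exact Ideal.mul_mono_left (hKJ.trans hJI))⟩
  exact span_range_ne_of_eq_zero (by simpa using hμ) b j hbj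
    (le_antisymm hKJ (hJ.2 hKI hKJ))

end Reductions

/-! ### Lengths of quotients of ideals. -/

section QuotLength

variable {R : Type*} [CommRing R]

lemma quotLength_add {A B C : Ideal R} (hCB : C ≤ B) (hBA : B ≤ A) :
    quotLength A C = quotLength A B + quotLength B C := by
  unfold quotLength
  let f : (B ⧸ Submodule.submoduleOf C B) →ₗ[R] (A ⧸ Submodule.submoduleOf C A) :=
    Submodule.mapQ _ _ (Submodule.inclusion hBA) (by
      rintro ⟨x, hx⟩ h
      exact h)
  let g : (A ⧸ Submodule.submoduleOf C A) →ₗ[R] (A ⧸ Submodule.submoduleOf B A) :=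
    Submodule.factor (by
      rintro ⟨x, hx⟩ h
      exact hCB h)
  rw [add_comm]
  refine Module.length_eq_add_of_exact f g ?_ ?_ ?_
  · rw [← LinearMap.ker_eq_bot, LinearMap.ker_eq_bot']
    intro x hx
    obtain ⟨⟨x, hxB⟩, rfl⟩ := Submodule.mkQ_surjective _ x
    have h1 : (Submodule.Quotient.mk (Submodule.inclusion hBA ⟨x, hxB⟩) :
      A ⧸ Submodule.submoduleOf C A) = 0 := hx
    rw [Submodule.Quotient.mk_eq_zero] at h1
    rw [Submodule.mkQ_apply, Submodule.Quotient.mk_eq_zero]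
    exact h1
  · intro x
    obtain ⟨⟨x, hxA⟩, rfl⟩ := Submodule.mkQ_surjective _ x
    exact ⟨Submodule.Quotient.mk ⟨x, hxA⟩, rfl⟩
  · intro x
    obtain ⟨⟨x, hxA⟩, rfl⟩ := Submodule.mkQ_surjective _ x
    change (Submodule.Quotient.mk (⟨x, hxA⟩ : A) : A ⧸ Submodule.submoduleOf B A) = 0 ↔ _
    rw [Submodule.Quotient.mk_eq_zero]
    constructor
    · intro h
      exact ⟨Submodule.Quotient.mk ⟨x, h⟩, rfl⟩
    · rintro ⟨y, hy⟩
      obtain ⟨⟨y, hyB⟩, rfl⟩ := Submodule.mkQ_surjective _ y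
      have h1 : (Submodule.Quotient.mk (⟨y, hBA hyB⟩ : A) : A ⧸ Submodule.submoduleOf C A) =
        Submodule.Quotient.mk ⟨x, hxA⟩ := hy
      rw [Submodule.Quotient.eq] at h1
      have h2 : y - x ∈ C := h1
      have h3 := B.sub_mem hyB (hCB h2)
      rw [sub_sub_cancel] at h3
      exact h3

lemma quotLength_eq_zero_iff {A B : Ideal R} : quotLength A B = 0 ↔ A ≤ B := by
  rw [quotLength, Module.length_eq_zero_iff, Submodule.Quotient.subsingleton_iff,
    Submodule.submoduleOf_eq_top]

/-- The submodule of A/B generated by the vᵢ is a quotient of a free module by relations with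
coefficients in 𝔪, so it maps onto the residue field to the power ι. -/
lemma card_le_quotLength [IsLocalRing R] {ι : Type*} [Fintype ι] {A B : Ideal R} (v : ι → R)
    (hv : ∀ i, v i ∈ A) (h : ∀ r : ι → R, ∑ i, r i * v i ∈ B → ∀ i, r i ∈ maximalIdeal R) :
    (Fintype.card ι : ℕ∞) ≤ quotLength A B := by
  let φ : (ι → R) →ₗ[R] (A ⧸ Submodule.submoduleOf B A) :=
    (Submodule.mkQ _).comp (Fintype.linearCombination R fun i => (⟨v i, hv i⟩ : A))
  have hφ : ∀ r, φ r = 0 → ∀ i, r i ∈ maximalIdeal R := by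
    intro r hr
    refine h r ?_
    have h1 : (Submodule.Quotient.mk (Fintype.linearCombination R (fun i => (⟨v i, hv i⟩ : A)) r) :
      A ⧸ Submodule.submoduleOf B A) = 0 := hr
    rw [Submodule.Quotient.mk_eq_zero, Fintype.linearCombination_apply, Submodule.submoduleOf,
      Submodule.mem_comap] at h1
    simpa using h1
  let ψ : (ι → R) →ₗ[R] (ι → ResidueField R) :=
    LinearMap.pi fun i => (Algebra.linearMap R (ResidueField R)).comp (LinearMap.proj i)
  have hψ : Function.Surjective ψ := by
    intro w
    choose r hr using fun i => residue_surjective (w i)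
    exact ⟨r, funext hr⟩
  have hle : LinearMap.ker φ ≤ LinearMap.ker ψ := by
    intro r hr
    rw [LinearMap.mem_ker]
    funext i
    exact (residue_eq_zero_iff _).2 (hφ r hr i)
  have h1 : Module.length R (ι → ResidueField R) = Fintype.card ι := by
    have : Module.length R (ResidueField R) = 1 := by
      rw [Module.length_eq_of_surjective (R := ResidueField R) residue_surjective,
        Module.length_eq_one_iff]
      infer_instance
    simp [this]
  rw [← h1]
  calc Module.length R (ι → ResidueField R)
      ≤ Module.length R ((ι → R) ⧸ LinearMap.ker φ) :=
        Module.length_le_of_surjective (Submodule.liftQ _ ψ hle) (by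
          intro w
          obtain ⟨r, rfl⟩ := hψ w
          exact ⟨Submodule.Quotient.mk r, rfl⟩)
    _ ≤ _ := Module.length_le_of_injective (Submodule.liftQ _ φ le_rfl)
        (LinearMap.ker_eq_bot.1 (Submodule.ker_liftQ_eq_bot _ _ _ le_rfl))

lemma quotLength_le_card_mul {ι : Type*} [Fintype ι] {A B Q : Ideal R} (v : ι → R)
    (hv : Ideal.span (Set.range v) = A) (hB : Q * A ≤ B) :
    quotLength A B ≤ Fintype.card ι * Module.length R (R ⧸ Q) := by
  classical
  have hvA : ∀ i, v i ∈ A := fun i => by rw [← hv]; exact Ideal.subset_span ⟨i, rfl⟩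
  let f : ι → (R ⧸ Q) →ₗ[R] (A ⧸ Submodule.submoduleOf B A) := fun i =>
    Submodule.liftQ Q (LinearMap.toSpanSingleton R _ (Submodule.Quotient.mk ⟨v i, hvA i⟩)) (by
      intro q hq
      rw [LinearMap.mem_ker, LinearMap.toSpanSingleton_apply, ← Submodule.Quotient.mk_smul,
        Submodule.Quotient.mk_eq_zero]
      exact hB (Ideal.mul_mem_mul hq (hvA i)))
  have h := Module.length_le_of_surjective (LinearMap.lsum R (fun _ : ι => R ⧸ Q) R f) (by
    intro x
    obtain ⟨⟨x, hxA⟩, rfl⟩ := Submodule.mkQ_surjective _ x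
    have hx := hxA
    rw [← hv, Ideal.mem_span_range_iff_exists_fun] at hx
    obtain ⟨c, hc⟩ := hx
    refine ⟨fun i => Submodule.Quotient.mk (c i), ?_⟩
    have h1 : ∀ i, f i (Submodule.Quotient.mk (c i)) =
        Submodule.mkQ _ (c i • (⟨v i, hvA i⟩ : A)) := fun i => rfl
    rw [LinearMap.lsum_apply]
    simp only [LinearMap.sum_apply, LinearMap.comp_apply, LinearMap.proj_apply, h1]
    rw [← map_sum]
    congr 1
    refine Subtype.ext ?_
    simp [← hc])
  refine h.trans ?_
  rw [Module.length_pi_of_fintype]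
  simp

end QuotLength

/-! ### An 𝔪-primary ideal without proper reductions needs exactly dim R generators. -/

section MinimalReduction

open MvPolynomial

variable {R : Type*} [CommRing R] [IsLocalRing R] [IsNoetherianRing R]

lemma Finset.mem_finsuppAntidiag_univ_iff {μ n : ℕ} {m : Fin μ →₀ ℕ} :
    m ∈ (Finset.univ : Finset (Fin μ)).finsuppAntidiag n ↔ m.degree = n := by
  rw [Finset.mem_finsuppAntidiag, Finsupp.degree_eq_sum]
  simp

omit [IsLocalRing R] [IsNoetherianRing R] in
lemma Ideal.finsupp_prod_pow_mem_pow_of_degree_eq {ι : Type*} {a : ι → R} {J : Ideal R} {m : ι →₀ ℕ}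
    {n : ℕ} (hm : m.degree = n) (ha : ∀ i, a i ∈ J) : (m.prod fun i k => a i ^ k) ∈ J ^ n :=
  hm ▸ Ideal.finsupp_prod_pow_mem_pow m fun i _ => ha i

/-- As polynomials in n the two sides have degrees μ and d, so the inequality for all n compares the
degrees. -/
lemma Nat.le_of_forall_choose_le_mul {μ d c : ℕ}
    (h : ∀ n, (n + μ).choose μ ≤ c * (n + d).choose d) : μ ≤ d := by
  by_contra! hlt
  -- Since (d + 1) C(n+d+1, d+1) = (n+d+1) C(n+d, d), this value of n makes the bound read n + d + 1
  -- ≤ n.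
  set n := c * (d + 1) with hn
  have h1 : (n + (d + 1)).choose (d + 1) ≤ (n + μ).choose μ := by
    rw [← Nat.choose_symm_add, ← Nat.choose_symm_add]
    exact Nat.choose_le_choose _ (by omega)
  have h2 := Nat.add_one_mul_choose_eq (n + d) d
  have h3 := h n
  have h4 : 0 < (n + d).choose d := Nat.choose_pos (by omega)
  have h5 : (n + d + 1) * (n + d).choose d ≤ (c * (n + d).choose d) * (d + 1) := by
    rw [h2]
    exact Nat.mul_le_mul_right _ (h1.trans h3)
  have h6 : (c * (n + d).choose d) * (d + 1) = n * (n + d).choose d := by rw [hn]; ring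
  rw [h6] at h5
  have := Nat.le_of_mul_le_mul_right h5 h4
  omega

omit [IsLocalRing R] [IsNoetherianRing R] in
lemma exists_fin_generators {J : Ideal R} (hfg : J.FG) :
    ∃ a : Fin J.spanFinrank → R, Ideal.span (Set.range a) = J := by
  obtain ⟨t, ht, hspan⟩ := Submodule.FG.exists_span_finset_card_eq_spanFinrank hfg
  refine ⟨fun i => (t.equivFinOfCardEq ht).symm i, Eq.trans (congrArg Ideal.span ?_) hspan⟩
  ext y
  constructor
  · rintro ⟨i, rfl⟩; simp
  · intro hy
    exact ⟨t.equivFinOfCardEq ht ⟨y, hy⟩, by simp⟩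

/-- An `𝔪`-primary ideal without proper reductions is generated by `dim R` elements, if the residue
field is infinite. -/
theorem spanFinrank_eq_of_forall_isReduction [Infinite (ResidueField R)] {J : Ideal R}
    (hJ : ∀ K, IsReduction K J → K = J) (hrad : J.radical = maximalIdeal R) {d : ℕ}
    (hdim : ringKrullDim R = d) : J.spanFinrank = d := by
  classical
  have hheight : (maximalIdeal R).height = d := by
    have := maximalIdeal_height_eq_ringKrullDim (R := R)
    rw [hdim] at this
    exact_mod_cast this
  have hfg : J.FG := IsNoetherian.noetherian J
  have hJm : J ≤ maximalIdeal R := hrad ▸ Ideal.le_radical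
  have hmin : ∀ Q : Ideal R, Q.radical = maximalIdeal R → maximalIdeal R ∈ Q.minimalPrimes := by
    intro Q hQ
    refine ⟨⟨inferInstance, hQ ▸ Ideal.le_radical⟩, fun P hP _ => ?_⟩
    rw [← hQ]
    exact hP.1.radical_le_iff.2 hP.2
  refine le_antisymm ?_ ?_
  · obtain ⟨s, hs, hcard⟩ :=
      Ideal.exists_finset_card_eq_height_of_isNoetherianRing (maximalIdeal R)
    rw [hheight] at hcard
    have hcard : s.card = d := by exact_mod_cast hcard
    obtain ⟨N, hN⟩ := Ideal.exists_pow_le_of_le_radical_of_fg hrad.ge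
      (IsNoetherian.noetherian (maximalIdeal R))
    -- Powers of a system of parameters, high enough to lie in J because 𝔪^N ⊆ J.
    let x : Fin d → R := fun i => ((s.equivFinOfCardEq hcard).symm i : R) ^ (N + 1)
    set Q := Ideal.span (Set.range x) with hQ
    have hsm : ∀ y ∈ s, y ∈ maximalIdeal R := fun y hy => hs.1.2 (Ideal.subset_span hy)
    have hQJ : Q ≤ J := by
      rw [hQ, Ideal.span_le]
      rintro _ ⟨i, rfl⟩
      exact hN (Ideal.pow_le_pow_right (Nat.le_succ N) (Ideal.pow_mem_pow (hsm _ (by simp)) _))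
    have hQrad : Q.radical = maximalIdeal R := by
      refine le_antisymm (hrad ▸ Ideal.radical_mono hQJ) ?_
      rw [Ideal.radical_eq_sInf]
      refine le_sInf fun P hP => ?_
      have hPprime : P.IsPrime := hP.2
      refine hs.2 ⟨hP.2, Ideal.span_le.2 fun y hy => ?_⟩ (le_maximalIdeal hP.2.ne_top)
      refine hPprime.mem_of_pow_mem (N + 1) (hP.1 (Ideal.subset_span
        ⟨s.equivFinOfCardEq hcard ⟨y, hy⟩, ?_⟩))
      simp [x]
    have hart := IsLocalRing.quotient_artinian_of_mem_minimalPrimes_of_isLocalRing Q (hmin Q hQrad)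
    have hfin : Module.length R (R ⧸ Q) ≠ ⊤ := by
      rw [Module.length_eq_of_surjective (R := R ⧸ Q) Ideal.Quotient.mk_surjective]
      exact Module.length_ne_top
    obtain ⟨c, hc⟩ := ENat.ne_top_iff_exists.1 hfin
    obtain ⟨a, ha⟩ := exists_fin_generators hfg
    -- The monomials of degree n in the generators of J are independent modulo 𝔪Jⁿ, so λ(R/Jⁿ) grows
    -- at least like a polynomial of degree μ(J). Below, λ(R/Qⁿ) grows at most like one of degree d,
    -- and Q ⊆ J.
    have lower : ∀ n, ((∑ i ∈ Finset.range n, (J.spanFinrank).multichoose i : ℕ) : ℕ∞) ≤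
        quotLength ⊤ (J ^ n) := by
      intro n
      induction n with
      | zero => simp
      | succ n ih =>
        rw [quotLength_add (Ideal.pow_le_pow_right (Nat.le_succ n)) le_top, Finset.sum_range_succ]
        push_cast
        push_cast at ih
        refine add_le_add ih ?_
        rw [quotLength_add (B := maximalIdeal R * J ^ n)
          (by rw [pow_succ']; exact Ideal.mul_mono_left hJm) Ideal.mul_le_right]
        refine le_trans ?_ le_self_add
        have h1 := Finset.card_finsuppAntidiag_nat_eq_multichoose
          (s := (Finset.univ : Finset (Fin J.spanFinrank))) n
        rw [Finset.card_univ, Fintype.card_fin, ← Fintype.card_coe] at h1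
        rw [← h1]
        refine card_le_quotLength (fun m => m.1.prod fun i k => a i ^ k) ?_ ?_
        · rintro ⟨m, hm⟩
          exact Ideal.finsupp_prod_pow_mem_pow_of_degree_eq
            (Finset.mem_finsuppAntidiag_univ_iff.1 hm) fun i => ha ▸ Ideal.subset_span ⟨i, rfl⟩
        · intro r hr
          by_contra! hcon
          obtain ⟨m₀, hm₀⟩ := hcon
          refine eval_notMem_of_forall_isReduction hJ rfl ha (n := n)
            (σ := ∑ m, monomial m.1 (r m)) ?_ ⟨m₀, ?_⟩ ?_
          · refine IsHomogeneous.sum _ _ _ fun m _ => isHomogeneous_monomial _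
              (Finset.mem_finsuppAntidiag_univ_iff.1 m.2)
          · have h2 : coeff m₀.1 (∑ m, monomial m.1 (r m)) = r m₀ := by
              rw [coeff_sum, Finset.sum_eq_single m₀]
              · simp
              · intro m _ hne
                rw [coeff_monomial, if_neg (fun h => hne (Subtype.ext h))]
              · simp
            rwa [h2]
          · simpa [eval_monomial] using hr
    have upper : ∀ n, quotLength ⊤ (Q ^ n) ≤
        ((∑ i ∈ Finset.range n, d.multichoose i : ℕ) : ℕ∞) * c := by
      intro n
      induction n with
      | zero =>
        rw [(quotLength_eq_zero_iff (R := R)).2 (by simp)]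
        exact zero_le
      | succ n ih =>
        rw [quotLength_add (Ideal.pow_le_pow_right (Nat.le_succ n)) le_top, Finset.sum_range_succ]
        push_cast
        push_cast at ih
        rw [add_mul]
        refine add_le_add ih ?_
        have h1 := Finset.card_finsuppAntidiag_nat_eq_multichoose
          (s := (Finset.univ : Finset (Fin d))) n
        rw [Finset.card_univ, Fintype.card_fin, ← Fintype.card_coe] at h1
        rw [← h1, hc]
        refine quotLength_le_card_mul (fun m => m.1.prod fun i k => x i ^ k) ?_ (pow_succ' Q n).ge
        refine le_antisymm ?_ ?_
        · rw [Ideal.span_le]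
          rintro _ ⟨⟨m, hm⟩, rfl⟩
          exact Ideal.finsupp_prod_pow_mem_pow_of_degree_eq
            (Finset.mem_finsuppAntidiag_univ_iff.1 hm) fun i => Ideal.subset_span ⟨i, rfl⟩
        · intro y hy
          obtain ⟨σ, hσ, rfl⟩ := exists_isHomogeneous_of_mem_pow hQ.symm hy
          rw [eval_eq]
          refine Ideal.sum_mem _ fun m hm => Ideal.mul_mem_left _ _ (Ideal.subset_span ?_)
          refine ⟨⟨m, ?_⟩, rfl⟩
          exact Finset.mem_finsuppAntidiag_univ_iff.2 (hσ.degree_eq (mem_support_iff.1 hm))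
    refine Nat.le_of_forall_choose_le_mul (c := c) fun n => ?_
    rw [← Nat.sum_range_multichoose, ← Nat.sum_range_multichoose, mul_comm]
    have h1 := lower (n + 1)
    have h2 := upper (n + 1)
    have h3 : quotLength ⊤ (J ^ (n + 1)) ≤ quotLength ⊤ (Q ^ (n + 1)) := by
      rw [quotLength_add (A := ⊤) (Ideal.pow_right_mono hQJ (n + 1)) le_top]
      exact le_self_add
    exact_mod_cast h1.trans (h3.trans h2)
  · have h1 := Ideal.height_le_spanRank_toENat_of_mem_minimalPrimes J _ (hmin J hrad)
    rw [hheight, Submodule.FG.spanRank_eq_spanFinrank hfg] at h1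
    simpa using h1

end MinimalReduction

/-! ### Relations between 1 and the yⱼt over the polynomial ring. -/

section FormsInReduction

open MvPolynomial

variable {R : Type*} [CommRing R] [IsLocalRing R] {d : ℕ}

/-- `J` is a reduction-like subideal of `I` generated by the quasi-regular family `a` such that
`J / 𝔪 J` embeds in `I / 𝔪 I`. -/
structure IsGoodReduction (I J : Ideal R) (a : Fin d → R) : Prop where
  span_eq : Ideal.span (Set.range a) = J
  quasiRegular : IsQuasiRegularOn a Set.univ
  le : J ≤ I
  le_maximalIdeal : I ≤ maximalIdeal R
  inf_le : J ⊓ maximalIdeal R * I ≤ maximalIdeal R * J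

namespace IsGoodReduction

variable {I J : Ideal R} {a : Fin d → R} (h : IsGoodReduction I J a)

include h

lemma mem (i : Fin d) : a i ∈ J := h.span_eq ▸ Ideal.subset_span ⟨i, rfl⟩

/-- Independence of the generators modulo Jⁿ𝔪I. Reducing modulo Jⁿ⁺¹ gives Σ (coefficient of τⱼ) yⱼ
∈ J + 𝔪I, and minimality of the yⱼ puts those coefficients in 𝔪. What remains is σ(a) ∈ Jⁿ𝔪I;
quasi-regularity and J ∩ 𝔪I = 𝔪J improve this to 𝔪Jⁿ⁺¹. -/
lemma coeff_mem_of_add_mem {r n : ℕ} {y : Fin r → R}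
    (hyI : ∀ j, y j ∈ I)
    (hy : ∀ s : Fin r → R, ∑ j, s j * y j ∈ J ⊔ maximalIdeal R * I → ∀ j, s j ∈ maximalIdeal R)
    {σ : MvPolynomial (Fin d) R} {τ : Fin r → MvPolynomial (Fin d) R}
    (hσ : σ.IsHomogeneous (n + 1)) (hτ : ∀ j, (τ j).IsHomogeneous n)
    (hmem : eval a σ + ∑ j, eval a (τ j) * y j ∈ J ^ n * (maximalIdeal R * I)) :
    (∀ m, coeff m σ ∈ maximalIdeal R) ∧ ∀ j m, coeff m (τ j) ∈ maximalIdeal R := by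
  have hJ := h.span_eq
  have hσJ := hσ.eval_mem_pow h.mem
  have hτm : ∀ j m, coeff m (τ j) ∈ maximalIdeal R := by
    intro j m
    obtain ⟨ρ, hρ, hρc, hρe⟩ := exists_isHomogeneous_of_mem_pow_mul hJ _ hmem
    have h1 := h.quasiRegular n (∑ j, C (y j) * τ j - ρ)
      ((IsHomogeneous.sum _ _ _ fun j _ => by
        simpa using (isHomogeneous_C (Fin d) (y j)).mul (hτ j)).sub hρ)
      (fun _ _ => Set.subset_univ _) (by
        rw [Set.image_univ, hJ, map_sub, hρe, map_sum]
        simp only [map_mul, eval_C]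
        have : ∑ j, y j * eval a (τ j) - (eval a σ + ∑ j, eval a (τ j) * y j) = - eval a σ := by
          rw [Finset.sum_congr rfl fun j _ => mul_comm (y j) (eval a (τ j))]
          ring
        rw [this]
        exact neg_mem hσJ) m
    rw [Set.image_univ, hJ, coeff_sub, coeff_sum] at h1
    simp only [coeff_C_mul] at h1
    refine hy (fun j => coeff m (τ j)) ?_ j
    have h2 := (J ⊔ maximalIdeal R * I).add_mem (Ideal.mem_sup_left h1)
      (Ideal.mem_sup_right (hρc m))
    rw [sub_add_cancel] at h2
    rwa [Finset.sum_congr rfl fun j _ => mul_comm (coeff m (τ j)) (y j)]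
  refine ⟨?_, hτm⟩
  have h1 : eval a σ ∈ J ^ n * (maximalIdeal R * I) := by
    refine (Ideal.add_mem_iff_left _ (Ideal.sum_mem _ fun j _ => ?_)).1 hmem
    rw [← mul_assoc]
    exact Ideal.mul_mem_mul ((hτ j).eval_mem_pow_mul h.mem (hτm j)) (hyI j)
  obtain ⟨ρ, hρ, hρc, hρe⟩ := exists_isHomogeneous_of_mem_pow_mul hJ _ h1
  have h2 := h.quasiRegular n ρ hρ (fun _ _ => Set.subset_univ _)
    (by rwa [Set.image_univ, hJ, hρe])
  rw [Set.image_univ, hJ] at h2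
  have h3 : eval a σ ∈ J ^ n * (maximalIdeal R * J) := by
    rw [← hρe]
    exact hρ.eval_mem_pow_mul h.mem fun m => h.inf_le ⟨h2 m, hρc m⟩
  rw [mul_comm (maximalIdeal R), ← mul_assoc, ← pow_succ] at h3
  exact h.quasiRegular.coeff_mem hJ (h.le.trans h.le_maximalIdeal) hσ h3

lemma exists_forms {r n : ℕ} {y : Fin r → R} (hy : J ⊔ Ideal.span (Set.range y) = I) {u : R}
    (hu : u ∈ J ^ n * I) :
    ∃ (σ : MvPolynomial (Fin d) R) (τ : Fin r → MvPolynomial (Fin d) R),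
      σ.IsHomogeneous (n + 1) ∧ (∀ j, (τ j).IsHomogeneous n) ∧
      u = eval a σ + ∑ j, eval a (τ j) * y j := by
  rw [← hy, Ideal.mul_sup, ← pow_succ, Submodule.mem_sup] at hu
  obtain ⟨v, hv, w, hw, rfl⟩ := hu
  obtain ⟨σ, hσ, rfl⟩ := exists_isHomogeneous_of_mem_pow h.span_eq hv
  rw [Ideal.span, ← smul_eq_mul, Submodule.mem_ideal_smul_span_iff_exists_sum] at hw
  obtain ⟨c, hc, rfl⟩ := hw
  choose τ hτ hτe using fun j => exists_isHomogeneous_of_mem_pow h.span_eq (hc j)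
  refine ⟨σ, τ, hσ, hτ, ?_⟩
  rw [Finsupp.sum_fintype _ _ (by simp)]
  simp [hτe]

/-- The relations between the generators `1, y₁ t, …` over the polynomial ring are multiples of the
single relation given by an element `c`. -/
lemma exists_form_of_add_mem {r n : ℕ} {y : Fin r → R} (hyI : ∀ j, y j ∈ I)
    (hy : ∀ s : Fin r → R, ∑ j, s j * y j ∈ J ⊔ maximalIdeal R * I → ∀ j, s j ∈ maximalIdeal R)
    {c : R} (hc : ∀ n, maximalIdeal R * I ^ (n + 2) ⊓ J ^ (n + 1) * I ≤
      J ^ n * (Ideal.span {c} ⊔ maximalIdeal R * (J * I)))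
    {γ : MvPolynomial (Fin d) R} {δ : Fin r → MvPolynomial (Fin d) R}
    (hγ : γ.IsHomogeneous 2) (hδ : ∀ j, (δ j).IsHomogeneous 1)
    (hcγ : c = eval a γ + ∑ j, eval a (δ j) * y j)
    {σ : MvPolynomial (Fin d) R} {τ : Fin r → MvPolynomial (Fin d) R}
    (hσ : σ.IsHomogeneous (n + 1)) (hτ : ∀ j, (τ j).IsHomogeneous n)
    (hmem : eval a σ + ∑ j, eval a (τ j) * y j ∈ maximalIdeal R * I ^ (n + 1)) :
    ∃ ρ : MvPolynomial (Fin d) R, (∀ m, coeff m (σ - ρ * γ) ∈ maximalIdeal R) ∧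
      ∀ j m, coeff m (τ j - ρ * δ j) ∈ maximalIdeal R := by
  cases n with
  -- In degree one there is no relation; those coming from c start in degree two.
  | zero =>
    refine ⟨0, ?_⟩
    simpa using h.coeff_mem_of_add_mem hyI hy hσ hτ (by simpa using hmem)
  | succ n =>
    have h1 : eval a σ + ∑ j, eval a (τ j) * y j ∈ J ^ (n + 1) * I := by
      refine add_mem ?_ (Ideal.sum_mem _ fun j _ =>
        Ideal.mul_mem_mul ((hτ j).eval_mem_pow h.mem) (hyI j))
      have := hσ.eval_mem_pow h.mem
      rw [pow_succ] at this
      exact Ideal.mul_mono_right h.le this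
    have h2 := hc n ⟨hmem, h1⟩
    rw [Ideal.mul_sup, Submodule.mem_sup] at h2
    obtain ⟨v, hv, w, hw, hvw⟩ := h2
    obtain ⟨v', hv', rfl⟩ := Ideal.mem_mul_span_singleton.1 hv
    obtain ⟨ρ, hρ, rfl⟩ := exists_isHomogeneous_of_mem_pow h.span_eq hv'
    refine ⟨ρ, h.coeff_mem_of_add_mem (n := n + 1) hyI hy (hσ.sub ?_) (fun j => (hτ j).sub ?_) ?_⟩
    · exact hρ.mul hγ
    · exact hρ.mul (hδ j)
    · have : eval a (σ - ρ * γ) + ∑ j, eval a (τ j - ρ * δ j) * y j = w := by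
        have h3 : ∑ j, eval a (τ j - ρ * δ j) * y j =
            ∑ j, eval a (τ j) * y j - eval a ρ * ∑ j, eval a (δ j) * y j := by
          rw [Finset.mul_sum, ← Finset.sum_sub_distrib]
          refine Finset.sum_congr rfl fun j _ => ?_
          rw [map_sub, map_mul]; ring
        rw [h3, map_sub, map_mul]
        rw [hcγ] at hvw
        linear_combination -hvw
      rw [this]
      rwa [mul_left_comm, ← mul_assoc (J ^ n), ← pow_succ, mul_left_comm] at hw

end IsGoodReduction

end FormsInReduction

/-! ### The polynomial ring acting on the fiber cone. -/

section FiberConeForms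

open MvPolynomial

variable {R : Type*} [CommRing R] [IsLocalRing R] {d : ℕ}

lemma MvPolynomial.sum_homogeneousComponent_of_totalDegree_lt {ι A : Type*} [CommSemiring A]
    {σ : MvPolynomial ι A} {N : ℕ} (hN : σ.totalDegree < N) :
    ∑ i ∈ Finset.range N, homogeneousComponent i σ = σ := by
  conv_rhs => rw [← sum_homogeneousComponent σ]
  symm
  refine Finset.sum_subset (Finset.range_subset_range.2 hN) fun i _ hi => ?_
  rw [Finset.mem_range, not_lt] at hi
  exact homogeneousComponent_eq_zero _ _ hi

lemma MvPolynomial.map_residue_eq_zero_iff {ι : Type*} {σ : MvPolynomial ι R} :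
    map (residue R) σ = 0 ↔ ∀ m, coeff m σ ∈ maximalIdeal R := by
  rw [MvPolynomial.ext_iff]
  simp only [coeff_map, coeff_zero, residue_eq_zero_iff]

/-- The class of `u tⁿ` in the fiber cone. -/
noncomputable def fiberConeMonomial (I : Ideal R) (n : ℕ) (u : R) (hu : u ∈ I ^ n) : FiberCone I :=
  Ideal.Quotient.mk (fiberConeRel I) ⟨Polynomial.monomial n u, reesAlgebra.monomial_mem.2 hu⟩

lemma mem_fiberConeRel {I : Ideal R} {f : reesAlgebra I} :
    f ∈ fiberConeRel I ↔ ∀ n, (f : Polynomial R).coeff n ∈ maximalIdeal R * I ^ n := Iff.rfl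

lemma fiberConeMonomial_eq_of_sub_mem {I : Ideal R} {n : ℕ} {u v : R} {hu : u ∈ I ^ n}
    {hv : v ∈ I ^ n} (h : u - v ∈ maximalIdeal R * I ^ n) :
    fiberConeMonomial I n u hu = fiberConeMonomial I n v hv := by
  rw [fiberConeMonomial, fiberConeMonomial, Ideal.Quotient.eq, mem_fiberConeRel]
  intro k
  rw [Subalgebra.coe_sub, ← map_sub, Polynomial.coeff_monomial]
  split_ifs with hk
  · rwa [← hk]
  · exact zero_mem _

lemma fiberConeMonomial_add {I : Ideal R} {n : ℕ} {u v : R} (hu : u ∈ I ^ n) (hv : v ∈ I ^ n) :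
    fiberConeMonomial I n (u + v) (add_mem hu hv) =
      fiberConeMonomial I n u hu + fiberConeMonomial I n v hv := by
  rw [fiberConeMonomial, fiberConeMonomial, fiberConeMonomial, ← map_add]
  congr 1
  exact Subtype.ext (map_add (Polynomial.monomial n) u v)

lemma mk_eq_sum_fiberConeMonomial {I : Ideal R} (p : reesAlgebra I) :
    (Ideal.Quotient.mk (fiberConeRel I) p) = ∑ n ∈ (p : Polynomial R).support,
      fiberConeMonomial I n ((p : Polynomial R).coeff n) (p.2 n) := by
  unfold fiberConeMonomial
  rw [← map_sum]
  congr 1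
  refine Subtype.ext ?_
  rw [AddSubmonoidClass.coe_finsetSum]
  exact (p : Polynomial R).as_sum_support

variable {I J : Ideal R} {a : Fin d → R}

/-- The homomorphism `R[X₁, …, X_d] → ⨁ Iⁿ tⁿ` sending `X i` to `a i * t`. -/
noncomputable def toReesAlgebra (I : Ideal R) (a : Fin d → R) (ha : ∀ i, a i ∈ I) :
    MvPolynomial (Fin d) R →ₐ[R] reesAlgebra I :=
  aeval fun i => ⟨Polynomial.monomial 1 (a i), reesAlgebra.monomial_mem.2 (by simpa using ha i)⟩

omit [IsLocalRing R] in
lemma coe_toReesAlgebra_monomial (ha : ∀ i, a i ∈ I) (m : Fin d →₀ ℕ) (r : R) :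
    (toReesAlgebra I a ha (monomial m r) : Polynomial R) =
      Polynomial.monomial m.degree (eval a (monomial m r)) := by
  have h1 : (toReesAlgebra I a ha (monomial m r) : Polynomial R) =
      (reesAlgebra I).val (toReesAlgebra I a ha (monomial m r)) := rfl
  rw [h1, toReesAlgebra, aeval_monomial, map_mul, AlgHom.commutes, eval_monomial]
  have h2 : (reesAlgebra I).val (m.prod fun i k => (⟨Polynomial.monomial 1 (a i),
      reesAlgebra.monomial_mem.2 (by simpa using ha i)⟩ : reesAlgebra I) ^ k) =
      Polynomial.monomial m.degree (m.prod fun i k => a i ^ k) := by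
    rw [Finsupp.prod, map_prod, Finsupp.prod, Finsupp.degree_apply]
    simp only [map_pow, Subalgebra.coe_val, Polynomial.monomial_pow, one_mul]
    induction m.support using Finset.induction_on with
    | empty => simp
    | insert i s hi ih =>
      rw [Finset.prod_insert hi, Finset.prod_insert hi, Finset.sum_insert hi, ih,
        Polynomial.monomial_mul_monomial]
  rw [h2, ← Polynomial.C_eq_algebraMap, Polynomial.C_mul_monomial]

omit [IsLocalRing R] in
lemma coeff_toReesAlgebra (ha : ∀ i, a i ∈ I) (σ : MvPolynomial (Fin d) R) (n : ℕ) :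
    (toReesAlgebra I a ha σ : Polynomial R).coeff n = eval a (homogeneousComponent n σ) := by
  induction σ using MvPolynomial.induction_on' with
  | monomial m r =>
    rw [coe_toReesAlgebra_monomial, Polynomial.coeff_monomial,
      homogeneousComponent_of_mem (isHomogeneous_monomial r rfl)]
    simp only [eq_comm (a := n)]
    split_ifs <;> simp
  | add p q hp hq =>
    rw [map_add, Subalgebra.coe_add, Polynomial.coeff_add, hp, hq, map_add, map_add]

omit [IsLocalRing R] in
lemma toReesAlgebra_of_isHomogeneous (ha : ∀ i, a i ∈ I) {σ : MvPolynomial (Fin d) R} {n : ℕ}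
    (hσ : σ.IsHomogeneous n) : (toReesAlgebra I a ha σ : Polynomial R) =
      Polynomial.monomial n (eval a σ) := by
  ext k
  rw [coeff_toReesAlgebra, homogeneousComponent_of_mem hσ, Polynomial.coeff_monomial]
  simp only [eq_comm (a := n)]
  split_ifs <;> simp

/-- The residue field as the degree zero part of the fiber cone. -/
noncomputable def residueFieldToFiberCone (I : Ideal R) : ResidueField R →+* FiberCone I :=
  Ideal.Quotient.lift (maximalIdeal R)
    ((Ideal.Quotient.mk (fiberConeRel I)).comp (algebraMap R (reesAlgebra I))) (by
      intro r hr
      rw [RingHom.comp_apply, Ideal.Quotient.eq_zero_iff_mem, mem_fiberConeRel]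
      intro n
      change (Polynomial.C r).coeff n ∈ _
      rw [Polynomial.coeff_C]
      split_ifs with hn
      · subst hn; simpa using hr
      · exact zero_mem _)

/-- The homomorphism from the polynomial ring over the residue field to the fiber cone. -/
noncomputable def toFiberCone (I : Ideal R) (a : Fin d → R) (ha : ∀ i, a i ∈ I) :
    MvPolynomial (Fin d) (ResidueField R) →+* FiberCone I :=
  eval₂Hom (residueFieldToFiberCone I)
    fun i => fiberConeMonomial I 1 (a i) (by simpa using ha i)

lemma toFiberCone_map (ha : ∀ i, a i ∈ I) (σ : MvPolynomial (Fin d) R) :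
    toFiberCone I a ha (map (residue R) σ) =
      Ideal.Quotient.mk (fiberConeRel I) (toReesAlgebra I a ha σ) := by
  have : (toFiberCone I a ha).comp (map (residue R)) =
      (Ideal.Quotient.mk (fiberConeRel I)).comp (toReesAlgebra I a ha).toRingHom := by
    refine MvPolynomial.ringHom_ext (fun r => ?_) fun i => ?_
    · simp only [RingHom.comp_apply, map_C, toFiberCone, coe_eval₂Hom, eval₂_C]
      change Ideal.Quotient.mk (fiberConeRel I) _ = Ideal.Quotient.mk (fiberConeRel I)
        (toReesAlgebra I a ha (algebraMap R _ r))
      rw [AlgHom.commutes]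
    · simp only [RingHom.comp_apply, map_X, toFiberCone, coe_eval₂Hom, eval₂_X]
      change _ = Ideal.Quotient.mk (fiberConeRel I) (toReesAlgebra I a ha (X i))
      rw [toReesAlgebra, aeval_X]
      rfl
  exact RingHom.congr_fun this σ

lemma fiberConeMonomial_eval_mul (ha : ∀ i, a i ∈ I) {σ : MvPolynomial (Fin d) R} {n k : ℕ}
    (hσ : σ.IsHomogeneous n) {w : R} (hw : w ∈ I ^ k) (hm : eval a σ * w ∈ I ^ (n + k)) :
    fiberConeMonomial I (n + k) (eval a σ * w) hm =
      toFiberCone I a ha (map (residue R) σ) * fiberConeMonomial I k w hw := by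
  rw [toFiberCone_map, fiberConeMonomial, fiberConeMonomial, ← map_mul]
  congr 1
  refine Subtype.ext ?_
  change Polynomial.monomial (n + k) (eval a σ * w) =
    (toReesAlgebra I a ha σ : Polynomial R) * Polynomial.monomial k w
  rw [toReesAlgebra_of_isHomogeneous ha hσ, Polynomial.monomial_mul_monomial]

lemma fiberConeMonomial_mem_irrelevant {n : ℕ} {u : R} (hu : u ∈ I ^ n) (hn : n ≠ 0) :
    fiberConeMonomial I n u hu ∈ fiberConeIrrelevant I := by
  refine Ideal.mem_map_of_mem _ ?_
  rw [RingHom.mem_ker]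
  change (Polynomial.monomial n u).coeff 0 = 0
  rw [Polynomial.coeff_monomial, if_neg hn]

lemma fiberConeIrrelevant_ne_top (I : Ideal R) : fiberConeIrrelevant I ≠ ⊤ := by
  let f : reesAlgebra I →+* R := Polynomial.constantCoeff.comp (reesAlgebra I).val.toRingHom
  let g : FiberCone I →+* ResidueField R :=
    Ideal.Quotient.lift (fiberConeRel I) ((residue R).comp f) (by
      intro p hp
      rw [RingHom.comp_apply, residue_eq_zero_iff]
      have := hp 0
      rw [pow_zero, Ideal.one_eq_top, Ideal.mul_top] at this
      exact this)
  intro htop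
  have hle : fiberConeIrrelevant I ≤ RingHom.ker g := by
    refine Ideal.map_le_iff_le_comap.2 fun p hp => ?_
    rw [Ideal.mem_comap, RingHom.mem_ker]
    change residue R (f p) = 0
    rw [show f p = 0 from hp, map_zero]
  rw [htop, top_le_iff] at hle
  exact RingHom.ker_ne_top g hle

end FiberConeForms

/-! ### The submodule N generated by 1 and the yⱼt, and its quotient. -/

section DepthOfFiberCone

open MvPolynomial

variable {R : Type*} [CommRing R] [IsLocalRing R] {d r : ℕ} {I J : Ideal R} {a : Fin d → R}
  {y : Fin r → R}

/-- The element `σ₀ + ∑ σⱼ yⱼ t` of the Rees algebra. -/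
noncomputable def reesCombination (I : Ideal R) (a : Fin d → R) (ha : ∀ i, a i ∈ I)
    (y : Fin r → R) (hy : ∀ j, y j ∈ I) (σ : Option (Fin r) → MvPolynomial (Fin d) R) :
    reesAlgebra I :=
  toReesAlgebra I a ha (σ none) + ∑ j, toReesAlgebra I a ha (σ (some j)) *
    ⟨Polynomial.monomial 1 (y j), reesAlgebra.monomial_mem.2 (by simpa using hy j)⟩

/-- The map `(s₀, s₁, …) ↦ s₀ + ∑ sⱼ yⱼ t` to the fiber cone. -/
noncomputable def fiberConeCombination (I : Ideal R) (a : Fin d → R) (ha : ∀ i, a i ∈ I)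
    (y : Fin r → R) (hy : ∀ j, y j ∈ I) :
    (Option (Fin r) → MvPolynomial (Fin d) (ResidueField R)) →+ FiberCone I where
  toFun s := toFiberCone I a ha (s none) + ∑ j, toFiberCone I a ha (s (some j)) *
    fiberConeMonomial I 1 (y j) (by simpa using hy j)
  map_zero' := by simp
  map_add' s t := by
    simp only [Pi.add_apply, map_add, add_mul, Finset.sum_add_distrib]
    abel

variable (ha : ∀ i, a i ∈ I) (hyI : ∀ j, y j ∈ I)

lemma fiberConeCombination_map (σ : Option (Fin r) → MvPolynomial (Fin d) R) :
    fiberConeCombination I a ha y hyI (fun i => map (residue R) (σ i)) =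
      Ideal.Quotient.mk (fiberConeRel I) (reesCombination I a ha y hyI σ) := by
  rw [reesCombination, map_add, map_sum]
  simp only [map_mul]
  change toFiberCone I a ha (map (residue R) (σ none)) +
    ∑ j, toFiberCone I a ha (map (residue R) (σ (some j))) * _ = _
  simp only [toFiberCone_map]
  rfl

omit [IsLocalRing R] in
lemma coeff_zero_reesCombination (σ : Option (Fin r) → MvPolynomial (Fin d) R) :
    (reesCombination I a ha y hyI σ : Polynomial R).coeff 0 =
      eval a (homogeneousComponent 0 (σ none)) := by
  rw [reesCombination, Subalgebra.coe_add, AddSubmonoidClass.coe_finsetSum, Polynomial.coeff_add,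
    Polynomial.finsetSum_coeff, coeff_toReesAlgebra, add_eq_left]
  refine Finset.sum_eq_zero fun j _ => ?_
  rw [Subalgebra.coe_mul, Polynomial.mul_coeff_zero, Polynomial.coeff_monomial]
  simp

omit [IsLocalRing R] in
lemma coeff_succ_reesCombination (σ : Option (Fin r) → MvPolynomial (Fin d) R) (n : ℕ) :
    (reesCombination I a ha y hyI σ : Polynomial R).coeff (n + 1) =
      eval a (homogeneousComponent (n + 1) (σ none)) +
        ∑ j, eval a (homogeneousComponent n (σ (some j))) * y j := by
  rw [reesCombination, Subalgebra.coe_add, AddSubmonoidClass.coe_finsetSum, Polynomial.coeff_add,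
    Polynomial.finsetSum_coeff, coeff_toReesAlgebra, add_right_inj]
  refine Finset.sum_congr rfl fun j _ => ?_
  rw [Subalgebra.coe_mul, Polynomial.coeff_mul_monomial, coeff_toReesAlgebra]

lemma exists_map_residue_eq (s : Option (Fin r) → MvPolynomial (Fin d) (ResidueField R)) :
    ∃ σ : Option (Fin r) → MvPolynomial (Fin d) R, s = fun i => map (residue R) (σ i) := by
  choose σ hσ using fun i => map_surjective (residue R) (residue_surjective) (s i)
  exact ⟨σ, funext fun i => (hσ i).symm⟩

/-- A vanishing combination is split into homogeneous components, where
`IsGoodReduction.exists_form_of_add_mem` gives a multiplier ρₙ in each degree; t is the sum of their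
residues. Conversely, (γ, δ) maps to the class of ct², which is zero since c ∈ 𝔪I². -/
lemma fiberConeCombination_eq_zero_iff (h : IsGoodReduction I J a)
    (hy : ∀ s : Fin r → R, ∑ j, s j * y j ∈ J ⊔ maximalIdeal R * I → ∀ j, s j ∈ maximalIdeal R)
    {c : R} (hcm : c ∈ maximalIdeal R * I ^ 2)
    (hc : ∀ n, maximalIdeal R * I ^ (n + 2) ⊓ J ^ (n + 1) * I ≤
      J ^ n * (Ideal.span {c} ⊔ maximalIdeal R * (J * I)))
    {γ : MvPolynomial (Fin d) R} {δ : Fin r → MvPolynomial (Fin d) R}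
    (hγ : γ.IsHomogeneous 2) (hδ : ∀ j, (δ j).IsHomogeneous 1)
    (hcγ : c = eval a γ + ∑ j, eval a (δ j) * y j)
    (s : Option (Fin r) → MvPolynomial (Fin d) (ResidueField R)) :
    fiberConeCombination I a ha y hyI s = 0 ↔ ∃ t : MvPolynomial (Fin d) (ResidueField R),
      s = t • fun i => map (residue R) (i.elim γ δ) := by
  constructor
  · intro hs
    obtain ⟨σ, rfl⟩ := exists_map_residue_eq s
    rw [fiberConeCombination_map, Ideal.Quotient.eq_zero_iff_mem, mem_fiberConeRel] at hs
    have h0 := hs 0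
    rw [coeff_zero_reesCombination, homogeneousComponent_zero, eval_C, pow_zero,
      Ideal.one_eq_top, Ideal.mul_top, ← residue_eq_zero_iff] at h0
    have h1 : ∀ n, ∃ ρ : MvPolynomial (Fin d) R,
        map (residue R) (homogeneousComponent (n + 1) (σ none)) =
          map (residue R) ρ * map (residue R) γ ∧
        ∀ j, map (residue R) (homogeneousComponent n (σ (some j))) =
          map (residue R) ρ * map (residue R) (δ j) := by
      intro n
      obtain ⟨ρ, h1, h2⟩ := h.exists_form_of_add_mem hyI hy hc hγ hδ hcγ
        (homogeneousComponent_isHomogeneous (n + 1) (σ none))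
        (fun j => homogeneousComponent_isHomogeneous n (σ (some j)))
        (by rw [← coeff_succ_reesCombination ha hyI]; exact hs (n + 1))
      have hsub : ∀ {τ γ : MvPolynomial (Fin d) R},
          (∀ m, coeff m (τ - ρ * γ) ∈ maximalIdeal R) →
          map (residue R) τ = map (residue R) ρ * map (residue R) γ := fun hτ => by
        rw [← map_mul, ← sub_eq_zero, ← map_sub, map_residue_eq_zero_iff]
        exact hτ
      exact ⟨ρ, hsub h1, fun j => hsub (h2 j)⟩
    choose ρ hρ0 hρ using h1
    let N := (σ none).totalDegree + ∑ j, (σ (some j)).totalDegree + 1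
    have hN0 : (σ none).totalDegree < N + 1 := by omega
    have hN : ∀ j, (σ (some j)).totalDegree < N := fun j => by
      have : (σ (some j)).totalDegree ≤ ∑ j, (σ (some j)).totalDegree :=
        Finset.single_le_sum (f := fun j => (σ (some j)).totalDegree)
          (fun _ _ => Nat.zero_le _) (Finset.mem_univ j)
      omega
    refine ⟨∑ n ∈ Finset.range N, map (residue R) (ρ n), funext fun i => ?_⟩
    rw [Pi.smul_apply, smul_eq_mul, Finset.sum_mul]
    cases i with
    | none =>
      conv_lhs => rw [← sum_homogeneousComponent_of_totalDegree_lt hN0]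
      rw [map_sum, Finset.sum_range_succ', homogeneousComponent_zero, map_C, h0, map_zero,
        add_zero]
      exact Finset.sum_congr rfl fun n _ => hρ0 n
    | some j =>
      conv_lhs => rw [← sum_homogeneousComponent_of_totalDegree_lt (hN j)]
      rw [map_sum]
      exact Finset.sum_congr rfl fun n _ => hρ n j
  · rintro ⟨t, rfl⟩
    have h1 : fiberConeCombination I a ha y hyI
        (t • fun i : Option (Fin r) => map (residue R) (i.elim γ δ)) = toFiberCone I a ha t *
          fiberConeCombination I a ha y hyI fun i => map (residue R) (i.elim γ δ) := by
      simp only [fiberConeCombination, AddMonoidHom.coe_mk, ZeroHom.coe_mk, Pi.smul_apply,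
        smul_eq_mul, map_mul, mul_add, Finset.mul_sum, mul_assoc]
    rw [h1, fiberConeCombination_map]
    convert mul_zero _
    rw [Ideal.Quotient.eq_zero_iff_mem, mem_fiberConeRel]
    have h2 : (reesCombination I a ha y hyI (fun i => i.elim γ δ) : Polynomial R) =
        Polynomial.monomial 2 c := by
      rw [reesCombination, Subalgebra.coe_add, AddSubmonoidClass.coe_finsetSum, hcγ, map_add,
        map_sum]
      simp only [Subalgebra.coe_mul, Option.elim]
      rw [toReesAlgebra_of_isHomogeneous ha hγ]
      simp only [toReesAlgebra_of_isHomogeneous ha (hδ _), Polynomial.monomial_mul_monomial]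
    intro n
    rw [h2, Polynomial.coeff_monomial]
    split_ifs with hn
    · rwa [← hn]
    · exact zero_mem _

lemma fiberConeMonomial_zero_mem_range (u : R) (hu : u ∈ I ^ 0) :
    fiberConeMonomial I 0 u hu ∈ (fiberConeCombination I a ha y hyI).range := by
  refine ⟨fun i => map (residue R) (i.elim (C u) 0), ?_⟩
  rw [fiberConeCombination_map, fiberConeMonomial]
  congr 1
  refine Subtype.ext ?_
  rw [reesCombination]
  simp

lemma IsGoodReduction.fiberConeMonomial_mem_range (h : IsGoodReduction I J a)
    (hyJ : J ⊔ Ideal.span (Set.range y) = I) {n : ℕ} {u : R} (hu : u ∈ J ^ n * I)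
    (hu' : u ∈ I ^ (n + 1)) :
    fiberConeMonomial I (n + 1) u hu' ∈ (fiberConeCombination I a ha y hyI).range := by
  obtain ⟨σ, τ, hσ, hτ, rfl⟩ := h.exists_forms hyJ hu
  refine ⟨fun i => map (residue R) (i.elim σ τ), ?_⟩
  rw [fiberConeCombination_map, fiberConeMonomial]
  congr 1
  refine Subtype.ext ?_
  change _ = Polynomial.monomial (n + 1) (eval a σ + ∑ j, eval a (τ j) * y j)
  rw [reesCombination, Subalgebra.coe_add, AddSubmonoidClass.coe_finsetSum, map_add, map_sum]
  simp only [Subalgebra.coe_mul, Option.elim]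
  rw [toReesAlgebra_of_isHomogeneous ha hσ]
  simp only [toReesAlgebra_of_isHomogeneous ha (hτ _), Polynomial.monomial_mul_monomial]

/-- Membership in N is a condition in each degree, and it is automatic in degrees 0 and 1 because 1
and I already lie in the generated part. -/
lemma IsGoodReduction.mk_mem_range_iff (h : IsGoodReduction I J a)
    (hyJ : J ⊔ Ideal.span (Set.range y) = I) (p : reesAlgebra I) :
    Ideal.Quotient.mk (fiberConeRel I) p ∈ (fiberConeCombination I a ha y hyI).range ↔
      ∀ n, (p : Polynomial R).coeff (n + 2) ∈ J ^ (n + 1) * I ⊔ maximalIdeal R * I ^ (n + 2) := by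
  constructor
  · rintro ⟨s, hs⟩ n
    obtain ⟨σ, rfl⟩ := exists_map_residue_eq s
    rw [fiberConeCombination_map, eq_comm, Ideal.Quotient.eq, mem_fiberConeRel] at hs
    have h1 := hs (n + 2)
    rw [Subalgebra.coe_sub, Polynomial.coeff_sub, coeff_succ_reesCombination] at h1
    have h2 : eval a (homogeneousComponent (n + 1 + 1) (σ none)) +
        ∑ j, eval a (homogeneousComponent (n + 1) (σ (some j))) * y j ∈ J ^ (n + 1) * I := by
      refine add_mem ?_ (Ideal.sum_mem _ fun j _ => Ideal.mul_mem_mul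
        ((homogeneousComponent_isHomogeneous _ _).eval_mem_pow h.mem) (hyI j))
      refine Ideal.mul_mono_right h.le ?_
      rw [← pow_succ]
      exact (homogeneousComponent_isHomogeneous _ _).eval_mem_pow h.mem
    have h3 := add_mem (Ideal.mem_sup_right (S := J ^ (n + 1) * I) h1) (Ideal.mem_sup_left h2)
    rwa [sub_add_cancel] at h3
  · intro hp
    rw [mk_eq_sum_fiberConeMonomial]
    refine sum_mem fun n _ => ?_
    match n with
    | 0 => exact fiberConeMonomial_zero_mem_range ha hyI _ _
    | 1 =>
      refine h.fiberConeMonomial_mem_range ha hyI hyJ (n := 0) ?_ _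
      simpa using p.2 1
    | n + 2 =>
      obtain ⟨v, hv, w, hw, hvw⟩ := Submodule.mem_sup.1 (hp n)
      have hvI : v ∈ I ^ (n + 2) := by
        rw [pow_succ]
        exact Ideal.mul_mono_left (Ideal.pow_right_mono h.le _) hv
      have h1 : fiberConeMonomial I (n + 2) ((p : Polynomial R).coeff (n + 2)) (p.2 (n + 2)) =
          fiberConeMonomial I (n + 2) v hvI :=
        fiberConeMonomial_eq_of_sub_mem (by rwa [← hvw, add_sub_cancel_left])
      rw [h1]
      exact h.fiberConeMonomial_mem_range ha hyI hyJ (n := n + 1) hv _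

/-- Torsion-freeness of F(I)/N follows from the homogeneous statement `hU` by a leading-term
argument: in the product of the top nonzero components of s and of x modulo N, every other
contribution to that degree is already in N. -/
lemma IsGoodReduction.mem_range_of_mul_mem (h : IsGoodReduction I J a)
    (hyJ : J ⊔ Ideal.span (Set.range y) = I)
    (hU : ∀ (k n : ℕ) (σ : MvPolynomial (Fin d) R) (u : R), σ.IsHomogeneous k →
      (∃ m, coeff m σ ∉ maximalIdeal R) → u ∈ I ^ (n + 2) →
      eval a σ * u ∈ J ^ (n + k + 1) * I ⊔ maximalIdeal R * I ^ (n + k + 2) →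
      u ∈ J ^ (n + 1) * I ⊔ maximalIdeal R * I ^ (n + 2))
    {s : MvPolynomial (Fin d) (ResidueField R)} (hs : s ≠ 0) {x : FiberCone I}
    (hx : toFiberCone I a ha s * x ∈ (fiberConeCombination I a ha y hyI).range) :
    x ∈ (fiberConeCombination I a ha y hyI).range := by
  obtain ⟨p, rfl⟩ := Ideal.Quotient.mk_surjective x
  obtain ⟨σ, rfl⟩ := map_surjective (residue R) residue_surjective s
  rw [toFiberCone_map, ← map_mul, h.mk_mem_range_iff ha hyI hyJ] at hx
  rw [h.mk_mem_range_iff ha hyI hyJ]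
  by_contra hp
  push Not at hp
  -- the largest degree in which `p` does not lie in the span
  obtain ⟨n, hn, hnmax⟩ : ∃ n, (p : Polynomial R).coeff (n + 2) ∉
      J ^ (n + 1) * I ⊔ maximalIdeal R * I ^ (n + 2) ∧ ∀ l, n < l →
      (p : Polynomial R).coeff (l + 2) ∈ J ^ (l + 1) * I ⊔ maximalIdeal R * I ^ (l + 2) := by
    classical
    obtain ⟨n₀, hn₀⟩ := hp
    have hb : ∀ l, (p : Polynomial R).coeff (l + 2) ∉
        J ^ (l + 1) * I ⊔ maximalIdeal R * I ^ (l + 2) → l ≤ (p : Polynomial R).natDegree := by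
      intro l hl
      by_contra hlt
      exact hl (by rw [Polynomial.coeff_eq_zero_of_natDegree_lt (by omega)]; exact zero_mem _)
    refine ⟨Nat.findGreatest (fun l => (p : Polynomial R).coeff (l + 2) ∉
      J ^ (l + 1) * I ⊔ maximalIdeal R * I ^ (l + 2)) (p : Polynomial R).natDegree,
      Nat.findGreatest_spec (P := fun l => (p : Polynomial R).coeff (l + 2) ∉
        J ^ (l + 1) * I ⊔ maximalIdeal R * I ^ (l + 2)) (hb _ hn₀) hn₀, fun l hl => ?_⟩
    by_contra hl'
    exact Nat.findGreatest_is_greatest hl (hb l hl') hl'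
  -- the largest degree in which `σ` does not vanish modulo the maximal ideal
  obtain ⟨k, hk, hkmax⟩ : ∃ k, map (residue R) (homogeneousComponent k σ) ≠ 0 ∧
      ∀ l, k < l → map (residue R) (homogeneousComponent l σ) = 0 := by
    classical
    have hb : ∀ l, map (residue R) (homogeneousComponent l σ) ≠ 0 → l ≤ σ.totalDegree := by
      intro l hl
      by_contra hlt
      exact hl (by rw [homogeneousComponent_eq_zero _ _ (by omega), map_zero])
    obtain ⟨k₀, hk₀⟩ : ∃ k, map (residue R) (homogeneousComponent k σ) ≠ 0 := by
      by_contra! hall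
      refine hs ?_
      rw [← sum_homogeneousComponent σ, map_sum]
      exact Finset.sum_eq_zero fun i _ => hall i
    refine ⟨Nat.findGreatest (fun l => map (residue R) (homogeneousComponent l σ) ≠ 0)
      σ.totalDegree, Nat.findGreatest_spec
        (P := fun l => map (residue R) (homogeneousComponent l σ) ≠ 0) (hb _ hk₀) hk₀,
      fun l hl => ?_⟩
    by_contra hl'
    exact Nat.findGreatest_is_greatest hl (hb l hl') hl'
  refine hn (hU k n (homogeneousComponent k σ) _ (homogeneousComponent_isHomogeneous k σ) ?_
    (p.2 (n + 2)) ?_)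
  · rw [Ne, map_residue_eq_zero_iff] at hk
    push Not at hk
    exact hk
  have h1 := hx (n + k)
  rw [Subalgebra.coe_mul, Polynomial.coeff_mul] at h1
  have hmem : (k, n + 2) ∈ Finset.HasAntidiagonal.antidiagonal (n + k + 2) := by
    rw [Finset.HasAntidiagonal.mem_antidiagonal]; simp only; omega
  rw [← Finset.add_sum_erase _ _ hmem] at h1
  simp only [coeff_toReesAlgebra] at h1
  refine (Ideal.add_mem_iff_left _ (Ideal.sum_mem _ ?_)).1 h1
  rintro ⟨i, j⟩ hij
  rw [Finset.mem_erase, Finset.HasAntidiagonal.mem_antidiagonal] at hij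
  obtain ⟨hne, hij⟩ := hij
  simp only at hij ⊢
  have hne' : i ≠ k := by
    rintro rfl
    exact hne (by rw [Prod.mk.injEq]; exact ⟨rfl, by omega⟩)
  rcases lt_or_gt_of_ne hne' with hlt | hgt
  · obtain ⟨l, rfl⟩ : ∃ l, j = l + 2 := ⟨j - 2, by omega⟩
    have h2 := Ideal.mul_mem_mul
      ((homogeneousComponent_isHomogeneous i σ).eval_mem_pow h.mem) (hnmax l (by omega))
    obtain rfl : l = n + k - i := by omega
    rw [Ideal.mul_sup, ← mul_assoc, ← pow_add] at h2
    have h3 : i + (n + k - i + 1) = n + k + 1 := by omega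
    rw [h3] at h2
    suffices hle : J ^ i * (maximalIdeal R * I ^ (n + k - i + 2)) ≤
        maximalIdeal R * I ^ (n + k + 2) from (sup_le_sup_left hle (J ^ (n + k + 1) * I) :) h2
    rw [mul_left_comm]
    refine Ideal.mul_mono_right ?_
    refine (Ideal.mul_mono_left (Ideal.pow_right_mono h.le i)).trans ?_
    rw [← pow_add, hij]
  · refine Ideal.mem_sup_right ?_
    have h2 := Ideal.mul_mem_mul ((homogeneousComponent_isHomogeneous i σ).eval_mem_pow_mul h.mem
      (map_residue_eq_zero_iff.1 (hkmax i hgt))) (p.2 j)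
    refine Ideal.mul_mono_right ?_ (by
      rw [mul_comm (J ^ i), mul_assoc] at h2; exact h2)
    refine (Ideal.mul_mono_left (Ideal.pow_right_mono h.le i)).trans ?_
    rw [← pow_add, hij]

lemma IsGoodReduction.exists_sub_mem_range (h : IsGoodReduction I J a)
    (hyJ : J ⊔ Ideal.span (Set.range y) = I) (hpow : ∀ n, I ^ (n + 2) = J ^ n * I ^ 2)
    {z₁ z₂ : R} (hz₁ : z₁ ∈ I ^ 2) (hz₂ : z₂ ∈ I ^ 2)
    (hz : I ^ 2 ≤ Ideal.span {z₁} ⊔ Ideal.span {z₂} ⊔ J * I) (x : FiberCone I) :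
    ∃ s t : MvPolynomial (Fin d) (ResidueField R),
      x - (toFiberCone I a ha s * fiberConeMonomial I 2 z₁ hz₁ +
        toFiberCone I a ha t * fiberConeMonomial I 2 z₂ hz₂) ∈
      (fiberConeCombination I a ha y hyI).range := by
  have hsum : ∀ (n : ℕ) (u : R) (hu : u ∈ I ^ n),
      ∃ s t : MvPolynomial (Fin d) (ResidueField R),
      fiberConeMonomial I n u hu - (toFiberCone I a ha s * fiberConeMonomial I 2 z₁ hz₁ +
        toFiberCone I a ha t * fiberConeMonomial I 2 z₂ hz₂) ∈
      (fiberConeCombination I a ha y hyI).range := by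
    intro n u hu
    match n with
    | 0 => exact ⟨0, 0, by simpa using fiberConeMonomial_zero_mem_range ha hyI u hu⟩
    | 1 =>
      refine ⟨0, 0, ?_⟩
      simpa using h.fiberConeMonomial_mem_range ha hyI hyJ (n := 0) (by simpa using hu) hu
    | n + 2 =>
      have h1 : u ∈ J ^ n * (Ideal.span {z₁} ⊔ Ideal.span {z₂} ⊔ J * I) :=
        Ideal.mul_mono_right hz (hpow n ▸ hu)
      rw [Ideal.mul_sup, Ideal.mul_sup, ← mul_assoc, ← pow_succ, Submodule.mem_sup] at h1
      obtain ⟨v, hv, w, hw, rfl⟩ := h1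
      obtain ⟨v₁, hv₁, v₂, hv₂, rfl⟩ := Submodule.mem_sup.1 hv
      obtain ⟨b₁, hb₁, rfl⟩ := Ideal.mem_mul_span_singleton.1 hv₁
      obtain ⟨b₂, hb₂, rfl⟩ := Ideal.mem_mul_span_singleton.1 hv₂
      obtain ⟨σ₁, hσ₁, rfl⟩ := exists_isHomogeneous_of_mem_pow h.span_eq hb₁
      obtain ⟨σ₂, hσ₂, rfl⟩ := exists_isHomogeneous_of_mem_pow h.span_eq hb₂
      have hm : ∀ {b z : R}, b ∈ J ^ n → z ∈ I ^ 2 → b * z ∈ I ^ (n + 2) := fun hb hz => by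
        rw [hpow n]; exact Ideal.mul_mem_mul hb hz
      have hwI : w ∈ I ^ (n + 2) := by
        rw [pow_succ]
        exact Ideal.mul_mono_left (Ideal.pow_right_mono h.le _) hw
      refine ⟨map (residue R) σ₁, map (residue R) σ₂, ?_⟩
      rw [fiberConeMonomial_add (add_mem (hm hb₁ hz₁) (hm hb₂ hz₂)) hwI,
        fiberConeMonomial_add (hm hb₁ hz₁) (hm hb₂ hz₂),
        fiberConeMonomial_eval_mul ha hσ₁ hz₁, fiberConeMonomial_eval_mul ha hσ₂ hz₂,
        add_sub_cancel_left]
      exact h.fiberConeMonomial_mem_range ha hyI hyJ (n := n + 1) hw _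
  obtain ⟨p, rfl⟩ := Ideal.Quotient.mk_surjective x
  choose s t hst using fun n => hsum n ((p : Polynomial R).coeff n) (p.2 n)
  rw [mk_eq_sum_fiberConeMonomial]
  refine ⟨∑ n ∈ (p : Polynomial R).support, s n, ∑ n ∈ (p : Polynomial R).support, t n, ?_⟩
  rw [map_sum, map_sum, Finset.sum_mul, Finset.sum_mul, ← Finset.sum_add_distrib,
    ← Finset.sum_sub_distrib]
  exact sum_mem fun n _ => hst n

end DepthOfFiberCone

/-! ### From the presentations to the depth of the fiber cone. -/

section DepthBound

open MvPolynomial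

/-- The form of `exists_isWeaklyRegular_lineForm` for an algebra given by a ring homomorphism. -/
lemma exists_isWeaklyRegular_map_lineForm {K A ι : Type*} [Field K] [Infinite K] [CommRing A]
    [Fintype ι] {e : ℕ} (φ : MvPolynomial (Fin (e + 1)) K →+* A) (y : ι → A) (z₁ z₂ : A)
    (N : AddSubgroup A)
    (hN : ∀ x, x ∈ N ↔ ∃ s : ι → MvPolynomial (Fin (e + 1)) K, ∑ i, φ (s i) * y i = x)
    (hker : ∃ g : ι → MvPolynomial (Fin (e + 1)) K, ∀ s : ι → MvPolynomial (Fin (e + 1)) K,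
      ∑ i, φ (s i) * y i = 0 ↔ ∃ t : MvPolynomial (Fin (e + 1)) K, s = t • g)
    (hgen : ∀ x : A, ∃ s t : MvPolynomial (Fin (e + 1)) K, x - (φ s * z₁ + φ t * z₂) ∈ N)
    (htf : ∀ (s : MvPolynomial (Fin (e + 1)) K) (x : A), s ≠ 0 → φ s * x ∈ N → x ∈ N) :
    ∃ c : Fin e → K,
      RingTheory.Sequence.IsWeaklyRegular A ((List.ofFn (lineForm c)).map φ) := by
  let := φ.toAlgebra
  have hspan : ∀ x, x ∈ Submodule.span (MvPolynomial (Fin (e + 1)) K) (Set.range y) ↔ x ∈ N :=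
    fun x => by
      rw [Submodule.mem_span_range_iff_exists_fun, hN]
      rfl
  obtain ⟨c, hc⟩ := exists_isWeaklyRegular_lineForm y z₁ z₂ hker
    (fun x => (hgen x).imp fun s hs => hs.imp fun t ht => (hspan _).2 ht)
    (fun s x hs hx => (hspan x).2 (htf s x hs ((hspan _).1 hx)))
  exact ⟨c, (RingTheory.Sequence.isWeaklyRegular_map_algebraMap_iff A A _).2 hc⟩

variable {R : Type*} [CommRing R] [IsLocalRing R] {e r : ℕ} {I J : Ideal R}
  {a : Fin (e + 1) → R} {y : Fin r → R}

/-- Isolates the ideal-theoretic input: `hc` says that c generates all relations of N, `hz` that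
F(I)/N has two generators, and `hU` that it is torsion-free. -/
theorem IsGoodReduction.le_fiberConeDepth [Infinite (ResidueField R)] (h : IsGoodReduction I J a)
    (hpow : ∀ n, I ^ (n + 2) = J ^ n * I ^ 2)
    (hyJ : J ⊔ Ideal.span (Set.range y) = I)
    (hy : ∀ s : Fin r → R, ∑ j, s j * y j ∈ J ⊔ maximalIdeal R * I → ∀ j, s j ∈ maximalIdeal R)
    {c z₁ z₂ : R} (hcm : c ∈ maximalIdeal R * I ^ 2) (hcJ : c ∈ J * I)
    (hc : ∀ n, maximalIdeal R * I ^ (n + 2) ⊓ J ^ (n + 1) * I ≤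
      J ^ n * (Ideal.span {c} ⊔ maximalIdeal R * (J * I)))
    (hz₁ : z₁ ∈ I ^ 2) (hz₂ : z₂ ∈ I ^ 2)
    (hz : I ^ 2 ≤ Ideal.span {z₁} ⊔ Ideal.span {z₂} ⊔ J * I)
    (hU : ∀ (k n : ℕ) (σ : MvPolynomial (Fin (e + 1)) R) (u : R), σ.IsHomogeneous k →
      (∃ m, coeff m σ ∉ maximalIdeal R) → u ∈ I ^ (n + 2) →
      eval a σ * u ∈ J ^ (n + k + 1) * I ⊔ maximalIdeal R * I ^ (n + k + 2) →
      u ∈ J ^ (n + 1) * I ⊔ maximalIdeal R * I ^ (n + 2)) :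
    (e : ℕ∞) ≤ fiberConeDepth I := by
  have ha : ∀ i, a i ∈ I := fun i => h.le (h.mem i)
  have hyI : ∀ j, y j ∈ I := fun j =>
    hyJ ▸ Ideal.mem_sup_right (Ideal.subset_span ⟨j, rfl⟩)
  let y' : Option (Fin r) → FiberCone I := fun i =>
    i.elim 1 fun j => fiberConeMonomial I 1 (y j) (by simpa using hyI j)
  have hcomb : ∀ s : Option (Fin r) → MvPolynomial (Fin (e + 1)) (ResidueField R),
      ∑ i, toFiberCone I a ha (s i) * y' i = fiberConeCombination I a ha y hyI s := by
    intro s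
    rw [Fintype.sum_option]
    change toFiberCone I a ha (s none) * 1 + _ = _
    rw [mul_one]
    rfl
  obtain ⟨γ, δ, hγ, hδ, hcγ⟩ := h.exists_forms (n := 1) hyJ (by simpa using hcJ)
  obtain ⟨b, hreg⟩ := exists_isWeaklyRegular_map_lineForm (toFiberCone I a ha) y'
    (fiberConeMonomial I 2 z₁ hz₁) (fiberConeMonomial I 2 z₂ hz₂)
    (fiberConeCombination I a ha y hyI).range
    (fun x => by simp only [hcomb]; rfl)
    ⟨fun i => map (residue R) (i.elim γ δ), fun s => by
      rw [hcomb]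
      exact fiberConeCombination_eq_zero_iff ha hyI h hy hcm hc hγ hδ hcγ s⟩
    (fun x => h.exists_sub_mem_range ha hyI hyJ hpow hz₁ hz₂ hz x)
    (fun s x hs hx => h.mem_range_of_mul_mem ha hyI hyJ hU hs hx)
  set l := (List.ofFn (lineForm b)).map (toFiberCone I a ha) with hl
  have hmem : ∀ x ∈ l, x ∈ fiberConeIrrelevant I := by
    intro x hx
    rw [hl, List.mem_map] at hx
    obtain ⟨f, hf, rfl⟩ := hx
    obtain ⟨i, rfl⟩ := (List.mem_ofFn' _ _).1 hf
    have hX : ∀ i, toFiberCone I a ha (X i) ∈ fiberConeIrrelevant I := by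
      intro i
      rw [toFiberCone, coe_eval₂Hom, eval₂_X]
      exact fiberConeMonomial_mem_irrelevant _ one_ne_zero
    rw [lineForm, map_sub, map_mul]
    exact sub_mem (hX _) (Ideal.mul_mem_left _ _ (hX _))
  have hreg' : RingTheory.Sequence.IsRegular (FiberCone I) l := by
    refine ⟨hreg, fun htop => fiberConeIrrelevant_ne_top I ?_⟩
    rw [smul_eq_mul, Ideal.mul_top] at htop
    rw [eq_top_iff, htop]
    exact Ideal.span_le.2 hmem
  have hlen : l.length = e := by rw [hl, List.length_map, List.length_ofFn]
  rw [fiberConeDepth, ringDepth, ← hlen]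
  exact le_iSup₂ (f := fun (rs : List (FiberCone I)) (_ : rs ∈ {rs : List (FiberCone I) |
    (∀ r ∈ rs, r ∈ fiberConeIrrelevant I) ∧ RingTheory.Sequence.IsRegular (FiberCone I) rs}) =>
    (rs.length : ℕ∞)) l ⟨hmem, hreg'⟩

end DepthBound

/-! ### Generators obtained from length bounds. -/

section Generators

variable {R : Type*} [CommRing R]

lemma ENat.le_of_add_le_add_one {a b : ℕ∞} {n : ℕ∞} (ha : a ≠ 0) (h : a + b ≤ n + 1) : b ≤ n := by
  have h1 : 1 + b ≤ n + 1 := (add_le_add_left (Order.one_le_iff_ne_zero.2 ha) b).trans h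
  rw [add_comm n] at h1
  exact (ENat.add_le_add_iff_left ENat.one_ne_top).1 h1

lemma exists_quotLength_span_sup_le {A B : Ideal R} (hBA : B ≤ A) {n : ℕ∞}
    (h : quotLength A B ≤ n + 1) : ∃ c ∈ A, quotLength A (Ideal.span {c} ⊔ B) ≤ n := by
  by_cases hAB : A ≤ B
  · refine ⟨0, zero_mem _, ?_⟩
    rw [quotLength_eq_zero_iff.2 (hAB.trans le_sup_right)]
    exact zero_le
  · obtain ⟨c, hcA, hcB⟩ := SetLike.not_le_iff_exists.1 hAB
    have hle : Ideal.span {c} ⊔ B ≤ A := sup_le ((Ideal.span_singleton_le_iff_mem _).2 hcA) hBA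
    rw [quotLength_add le_sup_right hle, add_comm] at h
    refine ⟨c, hcA, ENat.le_of_add_le_add_one (fun h0 => hcB ?_) h⟩
    exact quotLength_eq_zero_iff.1 h0 (Ideal.mem_sup_left (Ideal.mem_span_singleton_self c))

lemma exists_le_span_sup_of_quotLength_le_one {A B : Ideal R} (hBA : B ≤ A)
    (h : quotLength A B ≤ 1) : ∃ c ∈ A, A ≤ Ideal.span {c} ⊔ B := by
  obtain ⟨c, hc, h1⟩ := exists_quotLength_span_sup_le (n := 0) hBA (by simpa using h)
  exact ⟨c, hc, quotLength_eq_zero_iff.1 (le_antisymm h1 zero_le)⟩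

variable [IsLocalRing R]

/-- Take the least possible number of generators modulo J: a unit coefficient in a relation modulo J
+ 𝔪I would allow one to be dropped, by Nakayama. -/
lemma exists_minimal_generators_sup [IsNoetherianRing R] {I J : Ideal R} (hJI : J ≤ I) :
    ∃ (r : ℕ) (y : Fin r → R), J ⊔ Ideal.span (Set.range y) = I ∧
      ∀ s : Fin r → R, ∑ j, s j * y j ∈ J ⊔ maximalIdeal R * I → ∀ j, s j ∈ maximalIdeal R := by
  classical
  have hex : ∃ (r : ℕ) (y : Fin r → R), J ⊔ Ideal.span (Set.range y) = I := by
    obtain ⟨y, hy⟩ := exists_fin_generators (IsNoetherian.noetherian I)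
    exact ⟨_, y, by rw [hy, sup_eq_right.2 hJI]⟩
  obtain ⟨y, hy⟩ := Nat.find_spec hex
  refine ⟨_, y, hy, fun s hs j => ?_⟩
  by_contra hj
  have hmin := fun k => Nat.find_min hex (m := k)
  revert y s j hmin
  generalize Nat.find hex = r
  intro y hy s hs j hj hmin
  cases r with
  | zero => exact j.elim0
  | succ r =>
    refine hmin r (Nat.lt_succ_self r) ⟨fun i => y (j.succAbove i), le_antisymm ?_ ?_⟩
    · rw [← hy]
      exact sup_le_sup_left (Ideal.span_mono (by rintro _ ⟨i, rfl⟩; exact ⟨_, rfl⟩)) J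
    · refine Ideal.le_of_le_sup_maximalIdeal_mul (IsNoetherian.noetherian I) ?_
      have hyj : y j ∈ J ⊔ Ideal.span (Set.range fun i => y (j.succAbove i)) ⊔
          maximalIdeal R * I := by
        rw [mem_maximalIdeal, mem_nonunits_iff, not_not] at hj
        rw [← Ideal.unit_mul_mem_iff_mem _ hj]
        rw [Fin.sum_univ_succAbove _ j] at hs
        have h1 : ∑ i, s (j.succAbove i) * y (j.succAbove i) ∈
            Ideal.span (Set.range fun i => y (j.succAbove i)) :=
          Ideal.sum_mem _ fun i _ => Ideal.mul_mem_left _ _ (Ideal.subset_span ⟨i, rfl⟩)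
        refine (Ideal.add_mem_iff_left _ (Ideal.mem_sup_left (Ideal.mem_sup_right h1))).1 ?_
        exact (sup_le_sup_right (le_sup_left : J ≤ J ⊔ Ideal.span _) _ :) hs
      calc I = J ⊔ Ideal.span (Set.range y) := hy.symm
        _ ≤ _ := sup_le (le_sup_left.trans le_sup_left) (Ideal.span_le.2 ?_)
      rintro _ ⟨i, rfl⟩
      rcases Fin.eq_self_or_eq_succAbove j i with rfl | ⟨i, rfl⟩
      · exact hyj
      · exact Ideal.mem_sup_left (Ideal.mem_sup_right (Ideal.subset_span ⟨i, rfl⟩))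

end Generators

/-! ### The two cases: 𝔪I² inside JI, or I²/JI uniserial of length two. -/

section CaseAnalysis

open MvPolynomial

variable {R : Type*} [CommRing R] [IsLocalRing R] {d : ℕ} {I J : Ideal R} {a : Fin d → R}

omit [IsLocalRing R] in
-- Coefficientwise choice; `h0` covers the exponents outside the support, where the new coefficient
-- is zero.
lemma MvPolynomial.IsHomogeneous.exists_coeff_rel {ι : Type*} {n : ℕ} {σ : MvPolynomial ι R}
    (hσ : σ.IsHomogeneous n) {P : R → R → Prop} (h0 : P 0 0) (h : ∀ m, ∃ b, P (coeff m σ) b) :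
    ∃ ρ : MvPolynomial ι R, ρ.IsHomogeneous n ∧ ∀ m, P (coeff m σ) (coeff m ρ) := by
  classical
  choose f hf using h
  refine ⟨∑ m ∈ σ.support, monomial m (f m), IsHomogeneous.sum _ _ _ fun m hm => ?_, fun m => ?_⟩
  · exact isHomogeneous_monomial _ (hσ.degree_eq (mem_support_iff.1 hm))
  · rw [coeff_sum]
    simp only [coeff_monomial, Finset.sum_ite_eq']
    split_ifs with hm
    · exact hf m
    · rwa [notMem_support_iff.1 hm]

variable [IsNoetherianRing R]

lemma IsGoodReduction.mem_of_eval_mul_mem (h : IsGoodReduction I J a) {k n : ℕ}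
    {σ : MvPolynomial (Fin d) R} (hσ : σ.IsHomogeneous k) (hc : ∃ m, coeff m σ ∉ maximalIdeal R)
    {u : R} (hu : eval a σ * u ∈ J ^ (n + k) * I) : u ∈ J ^ n * I :=
  h.quasiRegular.mem_of_eval_mul_mem h.span_eq h.le hσ hc hu

lemma IsGoodReduction.coeff_mem_of_eval_mul_mem (h : IsGoodReduction I J a) {n : ℕ}
    {ρ : MvPolynomial (Fin d) R} (hρ : ρ.IsHomogeneous n)
    {w : R} (hw : w ∉ J * I) (he : eval a ρ * w ∈ J ^ (n + 1) * I) (m : Fin d →₀ ℕ) :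
    coeff m ρ ∈ maximalIdeal R := by
  by_contra hm
  refine hw ?_
  rw [add_comm] at he
  simpa using h.mem_of_eval_mul_mem hρ ⟨m, hm⟩ he

omit [IsNoetherianRing R] in
lemma IsGoodReduction.eval_mul_sub_mem (h : IsGoodReduction I J a) {n : ℕ} {σ ρ : MvPolynomial (Fin d) R}
    (hσ : σ.IsHomogeneous n) (hρ : ρ.IsHomogeneous n) (u w : R)
    (hc : ∀ m, coeff m σ * u - coeff m ρ * w ∈ J * I) :
    eval a σ * u - eval a ρ * w ∈ J ^ (n + 1) * I := by
  have h1 := IsHomogeneous.eval_mem_pow_mul (σ := C u * σ - C w * ρ) (n := n) (A := J * I) h.mem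
    (by
      have h2 := (isHomogeneous_C (Fin d) u).mul hσ
      have h3 := (isHomogeneous_C (Fin d) w).mul hρ
      rw [zero_add] at h2 h3
      exact h2.sub h3)
    (fun m => by rw [coeff_sub, coeff_C_mul, coeff_C_mul, mul_comm u, mul_comm w]; exact hc m)
  rw [map_sub, map_mul, map_mul, eval_C, eval_C, mul_comm u, mul_comm w] at h1
  rwa [pow_succ, mul_assoc]

omit [IsNoetherianRing R] in
lemma maximalIdeal_mul_pow_eq (hpow : ∀ n, I ^ (n + 2) = J ^ n * I ^ 2) (n : ℕ) :
    maximalIdeal R * I ^ (n + 2) = J ^ n * (maximalIdeal R * I ^ 2) := by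
  rw [hpow, mul_left_comm]

/-- The summand 𝔪Iⁿ⁺ᵏ⁺² is absorbed in Jⁿ⁺ᵏ⁺¹I, so the nonzerodivisor property suffices. -/
lemma IsGoodReduction.mem_of_eval_mul_mem_sup_of_le (h : IsGoodReduction I J a)
    (hpow : ∀ n, I ^ (n + 2) = J ^ n * I ^ 2) (hle : maximalIdeal R * I ^ 2 ≤ J * I) {k n : ℕ}
    {σ : MvPolynomial (Fin d) R} (hσ : σ.IsHomogeneous k) (hc : ∃ m, coeff m σ ∉ maximalIdeal R)
    {u : R} (hu : eval a σ * u ∈ J ^ (n + k + 1) * I ⊔ maximalIdeal R * I ^ (n + k + 2)) :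
    u ∈ J ^ (n + 1) * I := by
  refine h.mem_of_eval_mul_mem hσ hc ?_
  have h1 : J ^ (n + k + 1) * I ⊔ maximalIdeal R * I ^ (n + k + 2) ≤ J ^ (n + 1 + k) * I := by
    rw [add_right_comm n 1 k]
    refine sup_le le_rfl ?_
    rw [maximalIdeal_mul_pow_eq hpow, pow_succ J, mul_assoc]
    exact Ideal.mul_mono_right hle
  exact h1 hu

/-- The ideal `I ^ 2 / J I` is generated by `z`, and its maximal submodule is generated by `x z`
and is annihilated by the maximal ideal. -/
structure IsUniserialGenerator (I J : Ideal R) (z x : R) : Prop where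
  mem_sq : z ∈ I ^ 2
  sq_le : I ^ 2 ≤ Ideal.span {z} ⊔ J * I
  mem_maximalIdeal : x ∈ maximalIdeal R
  mul_notMem : x * z ∉ J * I
  maximalIdeal_mul_le : maximalIdeal R * I ^ 2 ≤ Ideal.span {x * z} ⊔ J * I
  mul_mem : ∀ r ∈ maximalIdeal R, r * (x * z) ∈ J * I

/-- If 𝔪I² is not inside JI, both layers of I² ⊇ JI + 𝔪I² ⊇ JI are nonzero, hence simple. The top
layer gives z; some x in 𝔪 moves z to a generator xz of the bottom layer, which 𝔪 kills. -/
lemma exists_isUniserialGenerator (hJI : J ≤ I)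
    (hlen : quotLength (I ^ 2) (J * I) ≤ 2) (hnot : ¬ maximalIdeal R * I ^ 2 ≤ J * I) :
    ∃ z x, IsUniserialGenerator I J z x := by
  have hJI2 : J * I ≤ I ^ 2 := by rw [pow_two]; exact Ideal.mul_mono_left hJI
  have hsup : J * I ⊔ maximalIdeal R * I ^ 2 ≤ I ^ 2 := sup_le hJI2 Ideal.mul_le_right
  have hadd := quotLength_add (le_sup_left : J * I ≤ J * I ⊔ maximalIdeal R * I ^ 2) hsup
  rw [hadd, ← one_add_one_eq_two] at hlen
  have hbot : quotLength (J * I ⊔ maximalIdeal R * I ^ 2) (J * I) ≤ 1 := by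
    refine ENat.le_of_add_le_add_one (fun h0 => hnot ?_) hlen
    exact Ideal.mul_le_right.trans (Ideal.le_of_le_sup_maximalIdeal_mul (IsNoetherian.noetherian _)
      (quotLength_eq_zero_iff.1 h0))
  have htop : quotLength (I ^ 2) (J * I ⊔ maximalIdeal R * I ^ 2) ≤ 1 := by
    rw [add_comm] at hlen
    exact ENat.le_of_add_le_add_one (fun h0 => hnot
      (le_sup_right.trans (quotLength_eq_zero_iff.1 h0))) hlen
  obtain ⟨z, hz, hzle⟩ := exists_le_span_sup_of_quotLength_le_one hsup htop
  rw [← sup_assoc] at hzle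
  replace hzle := Ideal.le_of_le_sup_maximalIdeal_mul (IsNoetherian.noetherian _) hzle
  obtain ⟨x, hx, hxz⟩ : ∃ x ∈ maximalIdeal R, x * z ∉ J * I := by
    by_contra! hall
    refine hnot ((Ideal.mul_mono_right hzle).trans ?_)
    rw [Ideal.mul_sup]
    refine sup_le (fun w hw => ?_) Ideal.mul_le_right
    obtain ⟨x, hx, rfl⟩ := Ideal.mem_mul_span_singleton.1 hw
    exact hall x hx
  have hxz' : Ideal.span {x * z} ⊔ J * I ≤ J * I ⊔ maximalIdeal R * I ^ 2 := by
    refine sup_le ((Ideal.span_singleton_le_iff_mem _).2 ?_) le_sup_left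
    exact Ideal.mem_sup_right (Ideal.mul_mem_mul hx hz)
  have hmem : x * z ∈ Ideal.span {x * z} ⊔ J * I :=
    Ideal.mem_sup_left (Ideal.mem_span_singleton_self _)
  rw [quotLength_add le_sup_right hxz', add_comm, ← zero_add (1 : ℕ∞)] at hbot
  have hB := hbot
  replace hbot := ENat.le_of_add_le_add_one
    (fun h0 => hxz (quotLength_eq_zero_iff.1 h0 hmem)) hbot
  replace hbot := quotLength_eq_zero_iff.1 (le_antisymm hbot zero_le)
  refine ⟨z, x, hz, hzle, hx, hxz, le_sup_right.trans hbot, fun r hr => ?_⟩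
  have hle : J * I ⊔ maximalIdeal R * Ideal.span {x * z} ≤ Ideal.span {x * z} ⊔ J * I :=
    sup_le le_sup_right (Ideal.mul_le_right.trans le_sup_left)
  replace hB := (le_add_right le_rfl : _ ≤ _).trans hB
  rw [quotLength_add le_sup_left hle] at hB
  have h0 := ENat.le_of_add_le_add_one (fun h0 => hxz ?_) hB
  · exact quotLength_eq_zero_iff.1 (le_antisymm h0 zero_le) (Ideal.mem_sup_right
      (Ideal.mul_mem_mul hr (Ideal.mem_span_singleton_self _)))
  · exact Ideal.le_of_le_sup_maximalIdeal_mul (IsNoetherian.noetherian _)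
      (le_sup_left.trans (quotLength_eq_zero_iff.1 h0)) (Ideal.mem_span_singleton_self _)

namespace IsUniserialGenerator

variable {z x : R} (hz : IsUniserialGenerator I J z x) (h : IsGoodReduction I J a)

include hz

omit [IsNoetherianRing R] in
lemma notMem : z ∉ J * I := fun hmem => hz.mul_notMem (Ideal.mul_mem_left _ _ hmem)

include h

/-- Descent along z, xz, 0. The coefficients of ρ lie in 𝔪 because z ∉ JI, so their products with z
are multiples b′xz modulo JI. The form with coefficients b′ again has its coefficients in 𝔪 because
xz ∉ JI, and 𝔪 kills xz modulo JI. -/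
lemma coeff_mul_mem {n : ℕ} {ρ : MvPolynomial (Fin d) R} (hρ : ρ.IsHomogeneous n)
    (he : eval a ρ * z ∈ J ^ (n + 1) * I) (m : Fin d →₀ ℕ) : coeff m ρ * z ∈ J * I := by
  have hm := h.coeff_mem_of_eval_mul_mem hρ hz.notMem he
  obtain ⟨ρ', hρ', hρρ'⟩ := hρ.exists_coeff_rel
    (P := fun b b' => b * z - b' * (x * z) ∈ J * I) (by simp) fun m => by
      obtain ⟨v, hv, w, hw, hvw⟩ := Submodule.mem_sup.1
        (hz.maximalIdeal_mul_le (Ideal.mul_mem_mul (hm m) hz.mem_sq))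
      obtain ⟨b, rfl⟩ := Ideal.mem_span_singleton'.1 hv
      exact ⟨b, by rwa [← hvw, add_sub_cancel_left]⟩
  have h1 := sub_mem he (h.eval_mul_sub_mem hρ hρ' z (x * z) hρρ')
  rw [sub_sub_cancel] at h1
  have h2 := hz.mul_mem _ (h.coeff_mem_of_eval_mul_mem hρ' hz.mul_notMem h1 m)
  have h3 := add_mem (hρρ' m) h2
  rwa [sub_add_cancel] at h3

/-- The element is a form with coefficients in 𝔪I², each a multiple of z modulo JI; `coeff_mul_mem`
shows that these multiples lie in JI. -/
lemma maximalIdeal_mul_pow_inf_le (hpow : ∀ n, I ^ (n + 2) = J ^ n * I ^ 2) (n : ℕ) :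
    maximalIdeal R * I ^ (n + 2) ⊓ J ^ (n + 1) * I ≤
      J ^ n * (maximalIdeal R * I ^ 2 ⊓ J * I) := by
  rintro w ⟨hw, hwJ⟩
  rw [SetLike.mem_coe, maximalIdeal_mul_pow_eq hpow] at hw
  obtain ⟨σ, hσ, hσc, rfl⟩ := exists_isHomogeneous_of_mem_pow_mul h.span_eq _ hw
  refine hσ.eval_mem_pow_mul h.mem fun m => ⟨hσc m, ?_⟩
  obtain ⟨ρ, hρ, hσρ⟩ := hσ.exists_coeff_rel
    (P := fun b b' => b * 1 - b' * z ∈ J * I) (by simp) fun m => by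
      obtain ⟨v, hv, w, hw, hvw⟩ := Submodule.mem_sup.1 (hz.sq_le (Ideal.mul_le_right (hσc m)))
      obtain ⟨b, rfl⟩ := Ideal.mem_span_singleton'.1 hv
      exact ⟨b, by rwa [← hvw, mul_one, add_sub_cancel_left]⟩
  have h1 := sub_mem hwJ (mul_one (eval a σ) ▸ h.eval_mul_sub_mem hσ hρ 1 z hσρ)
  rw [sub_sub_cancel] at h1
  have h2 := add_mem (hσρ m) (hz.coeff_mul_mem h hρ h1 m)
  rwa [sub_add_cancel, mul_one] at h2

/-- Modulo Jⁿ⁺¹I, u is ψ(a)z. If ψ had a unit coefficient, so would σψ, and subtracting a multiple x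
τ with x ∈ 𝔪 would leave a form with a unit coefficient sending z into Jⁿ⁺ᵏ⁺¹I, whence z ∈ JI. -/
lemma mem_of_eval_mul_mem_sup (hpow : ∀ n, I ^ (n + 2) = J ^ n * I ^ 2) {k n : ℕ}
    {σ : MvPolynomial (Fin d) R} (hσ : σ.IsHomogeneous k) (hc : ∃ m, coeff m σ ∉ maximalIdeal R)
    {u : R} (huI : u ∈ I ^ (n + 2))
    (hu : eval a σ * u ∈ J ^ (n + k + 1) * I ⊔ maximalIdeal R * I ^ (n + k + 2)) :
    u ∈ J ^ (n + 1) * I ⊔ maximalIdeal R * I ^ (n + 2) := by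
  have hpow' : ∀ n, J ^ n * (J * I) = J ^ (n + 1) * I := fun n => by rw [pow_succ, mul_assoc]
  have huI' : u ∈ J ^ n * (Ideal.span {z} ⊔ J * I) := by
    rw [hpow] at huI
    exact Ideal.mul_mono_right hz.sq_le huI
  rw [Ideal.mul_sup, hpow', Submodule.mem_sup] at huI'
  obtain ⟨v, hv, w, hw, rfl⟩ := huI'
  obtain ⟨b, hb, rfl⟩ := Ideal.mem_mul_span_singleton.1 hv
  obtain ⟨ψ, hψ, rfl⟩ := exists_isHomogeneous_of_mem_pow h.span_eq hb
  refine add_mem ?_ (Ideal.mem_sup_left hw)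
  by_cases hψm : ∀ m, coeff m ψ ∈ maximalIdeal R
  · refine Ideal.mem_sup_right ?_
    rw [maximalIdeal_mul_pow_eq hpow, ← mul_assoc]
    exact Ideal.mul_mem_mul (hψ.eval_mem_pow_mul h.mem hψm) hz.mem_sq
  exfalso
  have hσψ : ∃ m, coeff m (σ * ψ) ∉ maximalIdeal R := by
    by_contra! hall
    exact hψm (coeff_mem_of_coeff_mul_mem hc hall)
  have hσw : eval a σ * w ∈ J ^ (n + k + 1) * I := by
    have h1 := Ideal.mul_mem_mul (hσ.eval_mem_pow h.mem) hw
    rw [← mul_assoc, ← pow_add] at h1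
    rwa [show n + k + 1 = k + (n + 1) by ring]
  have h1 : eval a (σ * ψ) * z ∈ J ^ (n + k) * (Ideal.span {x * z} ⊔ J * I) := by
    have h2 := sub_mem hu (Ideal.mem_sup_left hσw)
    rw [← mul_sub, add_sub_cancel_right, ← mul_assoc, ← map_mul] at h2
    refine (sup_le ?_ ?_ :
      J ^ (n + k + 1) * I ⊔ maximalIdeal R * I ^ (n + k + 2) ≤ _) h2
    · rw [← hpow']
      exact Ideal.mul_mono_right le_sup_right
    · rw [maximalIdeal_mul_pow_eq hpow]
      exact Ideal.mul_mono_right hz.maximalIdeal_mul_le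
  rw [Ideal.mul_sup, hpow', Submodule.mem_sup] at h1
  obtain ⟨v', hv', w', hw', he⟩ := h1
  obtain ⟨b', hb', rfl⟩ := Ideal.mem_mul_span_singleton.1 hv'
  obtain ⟨τ, hτ, rfl⟩ := exists_isHomogeneous_of_mem_pow h.span_eq hb'
  have hhom : (σ * ψ - C x * τ).IsHomogeneous (n + k) := by
    refine IsHomogeneous.sub ?_ ?_
    · rw [add_comm]; exact hσ.mul hψ
    · simpa using (isHomogeneous_C (Fin d) x).mul hτ
  have hmem : eval a (σ * ψ - C x * τ) * z ∈ J ^ (n + k + 1) * I := by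
    have : eval a (σ * ψ - C x * τ) * z = w' := by
      rw [map_sub, map_mul (eval a) (C x), eval_C, sub_mul, ← he]
      ring
    rwa [this]
  obtain ⟨m, hm⟩ := hσψ
  refine hm ?_
  have h3 := h.coeff_mem_of_eval_mul_mem hhom hz.notMem hmem m
  rw [coeff_sub, coeff_C_mul] at h3
  have h4 := add_mem h3 (Ideal.mul_mem_right (coeff m τ) _ hz.mem_maximalIdeal)
  rwa [sub_add_cancel] at h4

end IsUniserialGenerator

end CaseAnalysis

/-! ### The depth bound for minimal reductions. -/

section MainTheorem

variable {R : Type*} [CommRing R] [IsLocalRing R] {I J : Ideal R}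

lemma IsMinimalReduction.exists_isGoodReduction [Infinite (ResidueField R)]
    (hCM : IsCohenMacaulayLocal R) {d : ℕ} (hdim : ringKrullDim R = d)
    (hI : I.radical = maximalIdeal R) (hJ : IsMinimalReduction J I) :
    ∃ a : Fin d → R, IsGoodReduction I J a := by
  have := hCM.1
  have hrad : J.radical = maximalIdeal R := (IsReduction.radical_eq hJ.1).trans hI
  have hrank : J.spanFinrank = d :=
    spanFinrank_eq_of_forall_isReduction (fun K hK => hJ.eq_of_isReduction hK) hrad hdim
  obtain ⟨a, ha⟩ : ∃ a : Fin d → R, Ideal.span (Set.range a) = J := by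
    rw [← hrank]
    exact exists_fin_generators (IsNoetherian.noetherian J)
  refine ⟨a, ha, ?_, hJ.1.1, hI ▸ Ideal.le_radical, hJ.inf_le hrank.symm ha⟩
  refine isQuasiRegularOn_univ_of_isWeaklyRegular
    (hCM.isWeaklyRegular hdim (List.length_ofFn) ?_)
  rw [← hrad, ← ha, Ideal.ofList]
  congr 2
  ext x
  simp [List.mem_ofFn]

theorem IsMinimalReduction.le_fiberConeDepth [Infinite (ResidueField R)]
    (hCM : IsCohenMacaulayLocal R) {e : ℕ} (hdim : ringKrullDim R = (e + 1 : ℕ))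
    (hI : I.radical = maximalIdeal R) (hJ : IsMinimalReduction J I) (hred : I ^ 3 = J * I ^ 2)
    (hlen : quotLength ((maximalIdeal R * I ^ 2) ⊓ J) (maximalIdeal R * J * I) = 1)
    (hlen2 : quotLength (I ^ 2) (J * I) ≤ 2) : (e : ℕ∞) ≤ fiberConeDepth I := by
  have := hCM.1
  obtain ⟨a, h⟩ := hJ.exists_isGoodReduction hCM hdim hI
  have hpow : ∀ n, I ^ (n + 2) = J ^ n * I ^ 2 := fun n => by
    rw [add_comm]; exact pow_add_eq_of_isReduction (n := 2) hred n
  obtain ⟨r, y, hyJ, hy⟩ := exists_minimal_generators_sup h.le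
  have hJI2 : J * I ≤ I ^ 2 := by rw [pow_two]; exact Ideal.mul_mono_left h.le
  -- The length hypothesis concerns 𝔪I² ∩ J; only its smaller part 𝔪I² ∩ JI matters, whose length
  -- over 𝔪JI is then at most one.
  obtain ⟨c, hcmem, hcle⟩ : ∃ c ∈ maximalIdeal R * I ^ 2 ⊓ J * I,
      maximalIdeal R * I ^ 2 ⊓ J * I ≤ Ideal.span {c} ⊔ maximalIdeal R * (J * I) := by
    have h1 : maximalIdeal R * J * I ≤ maximalIdeal R * I ^ 2 ⊓ J * I := by
      rw [mul_assoc]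
      exact le_inf (Ideal.mul_mono_right hJI2) Ideal.mul_le_right
    have h2 : maximalIdeal R * I ^ 2 ⊓ J * I ≤ maximalIdeal R * I ^ 2 ⊓ J :=
      inf_le_inf_left _ Ideal.mul_le_left
    rw [quotLength_add h1 h2] at hlen
    rw [← mul_assoc]
    exact exists_le_span_sup_of_quotLength_le_one h1 (hlen ▸ le_add_left le_rfl)
  by_cases hle : maximalIdeal R * I ^ 2 ≤ J * I
  · obtain ⟨z₂, hz₂, hlen1⟩ := exists_quotLength_span_sup_le (n := 1) hJI2
      (by rwa [one_add_one_eq_two])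
    obtain ⟨z₁, hz₁, hz⟩ := exists_le_span_sup_of_quotLength_le_one
      (sup_le ((Ideal.span_singleton_le_iff_mem _).2 hz₂) hJI2) hlen1
    refine h.le_fiberConeDepth hpow hyJ hy hcmem.1 hcmem.2 (fun n => ?_) hz₁ hz₂
      (by rwa [sup_assoc]) fun k n σ u hσ hc _ hu => Ideal.mem_sup_left
        (h.mem_of_eval_mul_mem_sup_of_le hpow hle hσ hc hu)
    rw [maximalIdeal_mul_pow_eq hpow]
    exact inf_le_left.trans (Ideal.mul_mono_right ((le_inf le_rfl hle).trans hcle))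
  · obtain ⟨z, x, hz⟩ := exists_isUniserialGenerator h.le hlen2 hle
    -- I²/JI is cyclic here, so z serves as both generators.
    refine h.le_fiberConeDepth hpow hyJ hy hcmem.1 hcmem.2 (fun n => ?_) hz.mem_sq hz.mem_sq
      (by rw [sup_idem]; exact hz.sq_le)
      fun k n σ u hσ hc huI hu => hz.mem_of_eval_mul_mem_sup h hpow hσ hc huI hu
    exact (hz.maximalIdeal_mul_pow_inf_le h hpow n).trans (Ideal.mul_mono_right hcle)

end MainTheorem

/-- The bounds `depth F(I) ≥ d - 1` and `depth F(I) ≥ d - 2` (integer subtraction) are written as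
`d ≤ depth F(I) + 1` and `d ≤ depth F(I) + 2`. -/
theorem corollary3p8 {R : Type*} [CommRing R] [IsLocalRing R]
    (hCM : IsCohenMacaulayLocal R) (hinf : Infinite (ResidueField R))
    (d : ℕ) (hdim : ringKrullDim R = d) (hd : 0 < d)
    (I J : Ideal R) (hI : I.radical = maximalIdeal R) (hJ : IsMinimalReduction J I)
    (hred : I ^ 3 = J * I ^ 2)
    (hlen : quotLength ((maximalIdeal R * I ^ 2) ⊓ J) (maximalIdeal R * J * I) = 1) :
    (quotLength (I ^ 2) (J * I) = 1 → (d : ℕ∞) ≤ fiberConeDepth I + 1) ∧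
    (quotLength (I ^ 2) (J * I) = 2 → (d : ℕ∞) ≤ fiberConeDepth I + 2) := by
  obtain ⟨e, rfl⟩ : ∃ e, d = e + 1 := ⟨d - 1, by omega⟩
  have key := fun h2 => hJ.le_fiberConeDepth hCM hdim hI hred hlen h2
  rw [Nat.cast_add, Nat.cast_one]
  refine ⟨fun h1 => add_le_add_left (key (h1.trans_le one_le_two)) 1, fun h2 => ?_⟩
  -- The bound d ≤ depth + 1 also holds here and is merely weakened.
  exact add_le_add (key h2.le) one_le_two
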